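/- \textbf{Definitions.} A polyomino is a finite nonempty set of unit cells of $\mathbb Z\times\mathbb Z$ connected through sides of cells; it is convex if each of its rows and columns is connected, and directed if every cell can be reached from some root cell by a path inside the polyomino using only unit north and east steps. A parallelogram polyomino is the region between two lattice paths (upper and lower) made of north and east unit steps that meet only at their common origin and extremity. Let $P$ be a polyomino without holes having $n\ge 1$ rows and $n$ columns, with the south-west corner of its bounding rectangle at $(1,1)$, and let $A_1,A_2,\dots$ be the corners of its boundary in clockwise order, $A_1$ being the lowest leftmost one. $P$ is a permutomino, of size $n+1$, if each of the point sets $\{A_1,A_3,\dots\}$ and $\{A_2,A_4,\dots\}$ is of the form $\{(i,\pi(i)) : 1\le i\le n+1\}$ for a permutation $\pi$ of $\{1,\dots,n+1\}$. By convention there is also an empty permutomino, of size $1$, which is counted as directed convex and as parallelogram. An entry of a permutation is a left-right (right-left) minimum if it is smaller than all entries to its left (right). A source of a permutation is an entry that is the first one, or the last one, or neither a left-right minimum nor a right-left minimum. A permutation is square if the sequence of its sources, read from left to right, is increasing up to some position and decreasing from there on (either part may be trivial). For permutations $\theta$ of size $m$ and $\theta'$ of size $m'$, the direct difference is $\theta\ominus\theta'=(\theta_1+m',\dots,\theta_m+m',\theta'_1,\dots,\theta'_{m'})$.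 A permutation of positive size is indecomposable if it is not the direct difference of two permutations of positive size. For $n\ge 0$ and $k\ge 2$ let $\mathcal B_{n,k}$ be the set of square permutations of size $n$ of the form $\theta_1\ominus\cdots\ominus\theta_k$ with all $\theta_i$ indecomposable, let $\mathcal B_n=\bigcup_{k\ge2}\mathcal B_{n,k}$, and let $\mathcal T_{n,k}$ be the set of sequences $(P_1,\dots,P_k)$ of permutominoes whose sizes sum to $n$, where $P_1$ and $P_k$ are possibly empty directed convex permutominoes and $P_2,\dots,P_{k-1}$ are possibly empty parallelogram permutominoes. Let $D(x)$ and $P(x)$ be the generating functions, by size, of possibly empty directed convex permutominoes and of possibly empty parallelogram permutominoes, and let $B_k(x)=\sum_{n\ge 0}|\mathcal B_{n,k}|x^n$ and $B(x)=\sum_{n\ge 0}|\mathcal B_n|x^n$. \textbf{Proposition.} For all $n\ge0$ and $k\ge2$ there is a bijection between $\mathcal B_{n,k}$ and $\mathcal T_{n,k}$; in particular $|\mathcal B_{n,k}|=|\mathcal T_{n,k}|$. Consequently, as formal power series, $$B_k(x)=D(x)^2P(x)^{k-2}\quad(k\ge 2),\qquad B(x)=\frac{D(x)^2}{1-P(x)}.$$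 -/

import Mathlib

namespace Permutomino

/-! ### Polyominoes

A cell is the unit square `[x, x+1] × [y, y+1]`, represented by its south-west corner `(x, y)`.
A finite union of cells is a `Finset (ℤ × ℤ)`. -/

/-- Two cells are adjacent when they share a side. -/
def cellGraph : SimpleGraph (ℤ × ℤ) where
  Adj c d := |c.1 - d.1| + |c.2 - d.2| = 1
  symm := ⟨fun c d h => by rw [abs_sub_comm d.1, abs_sub_comm d.2]; exact h⟩
  loopless := ⟨fun c h => by simp at h⟩

/-- A polyomino: a nonempty finite set of cells that is connected through sides of cells. -/
def IsPolyomino (P : Finset (ℤ × ℤ)) : Prop :=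
  P.Nonempty ∧ (cellGraph.induce (P : Set (ℤ × ℤ))).Preconnected

/-- No holes: the cells outside `P` form a connected region of the plane. -/
def HoleFree (P : Finset (ℤ × ℤ)) : Prop :=
  (cellGraph.induce ((P : Set (ℤ × ℤ))ᶜ)).Preconnected

/-- Convex: every column and every row of `P` is connected. -/
def IsConvex (P : Finset (ℤ × ℤ)) : Prop :=
  (∀ x : ℤ, {y : ℤ | (x, y) ∈ P}.OrdConnected) ∧ (∀ y : ℤ, {x : ℤ | (x, y) ∈ P}.OrdConnected)

/-- Directed: every cell is reached from a root cell by a path inside `P` that uses only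
north and east unit steps. -/
def IsDirected (P : Finset (ℤ × ℤ)) : Prop :=
  ∃ r ∈ P, ∀ c ∈ P,
    Relation.ReflTransGen
      (fun a b : ℤ × ℤ => b ∈ P ∧ (b = (a.1 + 1, a.2) ∨ b = (a.1, a.2 + 1))) r c

/-- The first `m` steps of `p` form a lattice path made of north and east unit steps. -/
def IsNEPath (m : ℕ) (p : ℕ → ℤ × ℤ) : Prop :=
  ∀ i < m, p (i + 1) = ((p i).1 + 1, (p i).2) ∨ p (i + 1) = ((p i).1, (p i).2 + 1)

/-- Parallelogram: `P` is the set of cells that lie between an upper path `u` and a lower path `l`,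
both made of north and east unit steps, which meet only at their common origin and at
their common extremity.  The cell `(x, y)` is between the paths when, in the column `x`, the
(unique) east step of `l` is at height at most `y` and that of `u` at height at least `y + 1`. -/
def IsParallelogram (P : Finset (ℤ × ℤ)) : Prop :=
  ∃ (m : ℕ) (u l : ℕ → ℤ × ℤ), IsNEPath m u ∧ IsNEPath m l ∧
    u 0 = l 0 ∧ u m = l m ∧
    (∀ i ≤ m, ∀ j ≤ m, u i = l j → (i = 0 ∧ j = 0) ∨ (i = m ∧ j = m)) ∧
    ∀ x y : ℤ, (x, y) ∈ P ↔
      ∃ a b : ℤ, a ≤ y ∧ y + 1 ≤ b ∧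
        (∃ i < m, l i = (x, a) ∧ l (i + 1) = (x + 1, a)) ∧
        (∃ j < m, u j = (x, b) ∧ u (j + 1) = (x + 1, b))

/-! ### The boundary, traversed clockwise (the interior is on the right-hand side) -/

/-- The clockwise boundary contains the unit step from `v` to `v + (0, 1)`. -/
def NorthStep (P : Finset (ℤ × ℤ)) (v : ℤ × ℤ) : Prop :=
  (v.1, v.2) ∈ P ∧ (v.1 - 1, v.2) ∉ P

/-- The clockwise boundary contains the unit step from `v` to `v - (0, 1)`. -/
def SouthStep (P : Finset (ℤ × ℤ)) (v : ℤ × ℤ) : Prop :=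
  (v.1 - 1, v.2 - 1) ∈ P ∧ (v.1, v.2 - 1) ∉ P

/-- The clockwise boundary contains the unit step from `v` to `v + (1, 0)`. -/
def EastStep (P : Finset (ℤ × ℤ)) (v : ℤ × ℤ) : Prop :=
  (v.1, v.2 - 1) ∈ P ∧ (v.1, v.2) ∉ P

/-- The clockwise boundary contains the unit step from `v` to `v - (1, 0)`. -/
def WestStep (P : Finset (ℤ × ℤ)) (v : ℤ × ℤ) : Prop :=
  (v.1 - 1, v.2) ∈ P ∧ (v.1 - 1, v.2 - 1) ∉ P

/-- The vertices (corners of the boundary) at which the clockwise boundary arrives horizontally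
and leaves vertically.  The boundary of a polyomino without holes is one simple closed curve,
whose sides are alternately vertical and horizontal, and the boundary leaves the lowest leftmost
vertex `A₁` northwards; so these are the vertices `A₁, A₃, A₅, …` of the clockwise
list of vertices `A₁, A₂, A₃, …`. -/
def oddVertices (P : Finset (ℤ × ℤ)) : Set (ℤ × ℤ) :=
  {v | (EastStep P (v.1 - 1, v.2) ∨ WestStep P (v.1 + 1, v.2)) ∧ (NorthStep P v ∨ SouthStep P v)}

/-- The vertices at which the clockwise boundary arrives vertically and leaves horizontally: for a
polyomino without holes these are the vertices `A₂, A₄, A₆, …` of the clockwise list. -/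
def evenVertices (P : Finset (ℤ × ℤ)) : Set (ℤ × ℤ) :=
  {v | (NorthStep P (v.1, v.2 - 1) ∨ SouthStep P (v.1, v.2 + 1)) ∧ (EastStep P v ∨ WestStep P v)}

/-- The points of `V` represent the permutation `π` of `{1, …, m}`: they are exactly the points
`(i, π(i))`, `1 ≤ i ≤ m` (while `Fin m` starts at `0`). -/
def Represents {m : ℕ} (V : Set (ℤ × ℤ)) (π : Equiv.Perm (Fin m)) : Prop :=
  V = Set.range fun i : Fin m => (((i : ℕ) : ℤ) + 1, ((π i : ℕ) : ℤ) + 1)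

/-- The size of a permutomino: its number of columns plus one.  The empty permutomino has
size `1`. -/
def size (P : Finset (ℤ × ℤ)) : ℕ := (P.image Prod.fst).card + 1

/-- Nonempty permutominoes: polyominoes without holes with `n ≥ 1` rows and columns, with the
south-west corner of the minimal bounding rectangle at `(1, 1)`, such that
the vertices `A₁, A₃, …` and the vertices `A₂, A₄, …` represent two permutations of
`{1, …, n + 1}`. -/
def IsPermutomino (P : Finset (ℤ × ℤ)) : Prop :=
  IsPolyomino P ∧ HoleFree P ∧
    ∃ n : ℕ, 1 ≤ n ∧ P.image Prod.fst = Finset.Icc (1 : ℤ) n ∧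
      P.image Prod.snd = Finset.Icc (1 : ℤ) n ∧
      (∃ π₁ : Equiv.Perm (Fin (n + 1)), Represents (oddVertices P) π₁) ∧
      (∃ π₂ : Equiv.Perm (Fin (n + 1)), Represents (evenVertices P) π₂)

/-- Possibly empty directed-convex permutominoes. -/
def directedConvex : Set (Finset (ℤ × ℤ)) :=
  {P | P = ∅ ∨ (IsPermutomino P ∧ IsConvex P ∧ IsDirected P)}

/-- Possibly empty parallelogram permutominoes. -/
def parallelogram : Set (Finset (ℤ × ℤ)) :=
  {P | P = ∅ ∨ (IsPermutomino P ∧ IsParallelogram P)}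

/-- The class `𝒯_{n,k}` of sequences `(P_1, …, P_k)` of total size `n` whose first and last terms
are possibly empty directed-convex permutominoes and whose other terms are possibly empty
parallelogram permutominoes. -/
def seqClass (n k : ℕ) : Set (Fin k → Finset (ℤ × ℤ)) :=
  {s | (∀ i : Fin k, ((i : ℕ) = 0 ∨ (i : ℕ) + 1 = k) → s i ∈ directedConvex) ∧
    (∀ i : Fin k, (i : ℕ) ≠ 0 → (i : ℕ) + 1 ≠ k → s i ∈ parallelogram) ∧
    ∑ i, size (s i) = n}

/-! ### Permutations -/

/-- `π(i)` is a left-right minimum. -/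
def IsLRMin {n : ℕ} (π : Equiv.Perm (Fin n)) (i : Fin n) : Prop := ∀ j < i, π i < π j

/-- `π(i)` is a right-left minimum. -/
def IsRLMin {n : ℕ} (π : Equiv.Perm (Fin n)) (i : Fin n) : Prop := ∀ j > i, π i < π j

/-- `π(i)` is a source: the first or the last entry, or an entry that is neither a left-right
minimum nor a right-left minimum. -/
def IsSource {n : ℕ} (π : Equiv.Perm (Fin n)) (i : Fin n) : Prop :=
  (i : ℕ) = 0 ∨ (i : ℕ) + 1 = n ∨ (¬ IsLRMin π i ∧ ¬ IsRLMin π i)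

/-- Square permutations: the sequence of the sources consists of (at most) two faces, an increasing
one followed by a decreasing one. -/
def IsSquare {n : ℕ} (π : Equiv.Perm (Fin n)) : Prop :=
  ∃ p : ℕ, StrictMonoOn π {i | IsSource π i ∧ (i : ℕ) ≤ p} ∧
    StrictAntiOn π {i | IsSource π i ∧ p ≤ (i : ℕ)}

/-- The direct difference `θ ⊖ θ' = (θ_1 + m', …, θ_m + m', θ'_1, …, θ'_{m'})`. -/
def directDiff {m m' : ℕ} (θ : Equiv.Perm (Fin m)) (θ' : Equiv.Perm (Fin m')) :
    Equiv.Perm (Fin (m + m')) :=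
  finSumFinEquiv.symm.trans ((Equiv.sumCongr θ θ').trans ((Equiv.sumComm _ _).trans
    (finSumFinEquiv.trans (finCongr (Nat.add_comm m' m)))))

theorem directDiff_castAdd {m m' : ℕ} (θ : Equiv.Perm (Fin m)) (θ' : Equiv.Perm (Fin m'))
    (i : Fin m) : (directDiff θ θ' (Fin.castAdd m' i) : ℕ) = (θ i : ℕ) + m' := by
  simp [directDiff, Nat.add_comm]

theorem directDiff_natAdd {m m' : ℕ} (θ : Equiv.Perm (Fin m)) (θ' : Equiv.Perm (Fin m'))
    (i : Fin m') : (directDiff θ θ' (Fin.natAdd m i) : ℕ) = (θ' i : ℕ) := by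
  simp [directDiff]

/-- Indecomposable: a permutation of positive size that is not the direct difference of two
permutations (of positive sizes). -/
def Indecomposable {n : ℕ} (π : Equiv.Perm (Fin n)) : Prop :=
  0 < n ∧ ¬ ∃ (m m' : ℕ) (h : m + m' = n) (θ : Equiv.Perm (Fin m)) (θ' : Equiv.Perm (Fin m')),
    0 < m ∧ 0 < m' ∧ π = (finCongr h).permCongr (directDiff θ θ')

/-- `IsDiffOf k π`: `π = θ_1 ⊖ ⋯ ⊖ θ_k` with all `θ_i` indecomposable (`⊖` is associative). -/
inductive IsDiffOf : ℕ → {n : ℕ} → Equiv.Perm (Fin n) → Prop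
  | one {n : ℕ} (θ : Equiv.Perm (Fin n)) : Indecomposable θ → IsDiffOf 1 θ
  | cons {k m n : ℕ} (θ : Equiv.Perm (Fin m)) (π : Equiv.Perm (Fin n)) :
      Indecomposable θ → IsDiffOf k π → IsDiffOf (k + 1) (directDiff θ π)

/-- The class `ℬ_{n,k}` of square permutations of size `n` that are the direct difference of
exactly `k` indecomposable permutations. -/
def permClass (n k : ℕ) : Set (Equiv.Perm (Fin n)) := {π | IsSquare π ∧ IsDiffOf k π}

/-- The class `ℬ_n`, the union of the classes `ℬ_{n,k}` for `k ≥ 2`. -/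
def permClassUnion (n : ℕ) : Set (Equiv.Perm (Fin n)) := {π | ∃ k, 2 ≤ k ∧ π ∈ permClass n k}

/-! ### Generating functions -/

/-- There are finitely many possibly empty permutominoes of a given size, so that the cardinalities
below are genuine ones. -/
theorem finite_of_size (n : ℕ) : {P | (P = ∅ ∨ IsPermutomino P) ∧ size P = n}.Finite := by
  refine (((Finset.Icc (1 : ℤ) n) ×ˢ (Finset.Icc (1 : ℤ) n)).powerset.finite_toSet).subset ?_
  rintro P ⟨hP | ⟨-, -, m, -, h1, h2, -, -⟩, hs⟩
  · simp [hP]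
  · have hm : m + 1 = n := by rw [← hs, size, h1]; simp
    simp only [Finset.coe_powerset, Set.mem_preimage, Set.mem_powerset_iff, Finset.coe_subset]
    intro c hc
    have a1 := Finset.mem_image_of_mem Prod.fst hc
    have a2 := Finset.mem_image_of_mem Prod.snd hc
    rw [h1, Finset.mem_Icc] at a1
    rw [h2, Finset.mem_Icc] at a2
    rw [Finset.mem_product, Finset.mem_Icc, Finset.mem_Icc]
    omega

/-- `D(x)`, the generating function by size of possibly empty directed-convex permutominoes. -/
noncomputable def genD : PowerSeries ℚ :=
  PowerSeries.mk fun n => ({P | P ∈ directedConvex ∧ size P = n}.ncard : ℚ)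

/-- `P(x)`, the generating function by size of possibly empty parallelogram permutominoes. -/
noncomputable def genP : PowerSeries ℚ :=
  PowerSeries.mk fun n => ({P | P ∈ parallelogram ∧ size P = n}.ncard : ℚ)

/-- `B_k(x)`, the generating function of the cardinalities of `ℬ_{n,k}`. -/
noncomputable def genBk (k : ℕ) : PowerSeries ℚ :=
  PowerSeries.mk fun n => ((permClass n k).ncard : ℚ)

/-- `B(x)`, the generating function of the cardinalities of `ℬ_n`. -/
noncomputable def genB : PowerSeries ℚ :=
  PowerSeries.mk fun n => ((permClassUnion n).ncard : ℚ)

/-- `P(x)` has no constant term, so `1 - P(x)` is invertible. -/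
theorem constantCoeff_one_sub_genP : PowerSeries.constantCoeff (1 - genP) ≠ 0 := by
  have h : {P : Finset (ℤ × ℤ) | P ∈ parallelogram ∧ size P = 0} = ∅ := by
    ext P; simp [size]
  rw [map_sub, genP, ← PowerSeries.coeff_zero_eq_constantCoeff_apply,
    ← PowerSeries.coeff_zero_eq_constantCoeff_apply, PowerSeries.coeff_mk, h]
  simp

end Permutomino

/-! A permutation is square exactly when every entry has an empty quadrant: SW, SE, NW or NE
(`SizedPerm.isSquare_iff`). In a direct difference, an entry always has points to its SE if a
component follows and to its NW if a component precedes, while the other quadrants only see the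
entry's own component. So squareness of `θ_1 ⊖ ⋯ ⊖ θ_k`, `k ≥ 2`, splits into independent
conditions: an empty SW, NW or NE quadrant in `θ_1`, SW or NE in the inner components, SW, SE or NE
in `θ_k` (`fourFaces_diff`, `lastFaces_diff`). Components are unique (`diff_injective`), and
inversion exchanges the conditions for `θ_1` and `θ_k` (`bijOn_inv`).

It remains to match indecomposable permutations with permutominoes. After complementation, the
condition for `θ_k` says that every point of the graph `S` has an empty NW, SE or NE quadrant. Such
an `S` is the set of even vertices of exactly one directed convex permutomino. Its cells are those
below the staircase of the points with empty NW quadrant, above the staircase of those with empty SE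
quadrant, and not to the north-east of a remaining point, which is a reflex vertex (`Region`). One
direction is `mem_iff_region`, the other `evenVertices_of_region` together with
`isPermutomino_of_region`; indecomposability keeps the staircases apart. Parallelogram permutominoes
are those without reflex vertices, which is the condition for inner components. This gives
`bijOn_cells` and `bijOn_cells_mid`, with the permutation of size 1 matching the empty permutomino.

Both generating functions then factor as `D · P^(k-2) · D`. The bijection between the two classes is
obtained from equality of their finite cardinalities. For the union over `k`, the series `T` of all
tails satisfies `T = D + P T`. -/

namespace Permutomino

/-! ### Sets of points that are graphs of permutations -/

/-- `S` is the set of points `(i, π i)` of a permutation `π` of `{1, …, n}`. -/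
structure IsPermSet (n : ℤ) (S : Set (ℤ × ℤ)) : Prop where
  bound : ∀ p ∈ S, 1 ≤ p.1 ∧ p.1 ≤ n ∧ 1 ≤ p.2 ∧ p.2 ≤ n
  inj_fst : ∀ p ∈ S, ∀ q ∈ S, p.1 = q.1 → p = q
  inj_snd : ∀ p ∈ S, ∀ q ∈ S, p.2 = q.2 → p = q
  surj_fst : ∀ x, 1 ≤ x → x ≤ n → ∃ y, (x, y) ∈ S
  surj_snd : ∀ y, 1 ≤ y → y ≤ n → ∃ x, (x, y) ∈ S

/-- No proper initial segment of `{1, …, n}` is mapped to itself. -/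
structure IsIndec (n : ℤ) (S : Set (ℤ × ℤ)) : Prop where
  above : ∀ x, 1 ≤ x → x < n → ∃ p ∈ S, p.1 ≤ x ∧ x < p.2
  below : ∀ x, 1 ≤ x → x < n → ∃ p ∈ S, p.2 ≤ x ∧ x < p.1

/-- The reflection of `S` in the diagonal. -/
def transpose (S : Set (ℤ × ℤ)) : Set (ℤ × ℤ) := {p | (p.2, p.1) ∈ S}

theorem mem_transpose {S : Set (ℤ × ℤ)} {x y : ℤ} : (x, y) ∈ transpose S ↔ (y, x) ∈ S := Iff.rfl

theorem IsPermSet.transpose {n : ℤ} {S : Set (ℤ × ℤ)} (h : IsPermSet n S) :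
    IsPermSet n (transpose S) where
  bound p hp := by have := h.bound _ hp; dsimp only at this; omega
  inj_fst p hp q hq e := by
    have := h.inj_snd _ hp _ hq e
    exact Prod.ext (congrArg Prod.snd this) (congrArg Prod.fst this)
  inj_snd p hp q hq e := by
    have := h.inj_fst _ hp _ hq e
    exact Prod.ext (congrArg Prod.snd this) (congrArg Prod.fst this)
  surj_fst := h.surj_snd
  surj_snd := h.surj_fst

theorem IsIndec.transpose {n : ℤ} {S : Set (ℤ × ℤ)} (h : IsIndec n S) :
    IsIndec n (transpose S) where
  above x h1 h2 := by obtain ⟨p, hp⟩ := h.below x h1 h2; exact ⟨p.swap, hp⟩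
  below x h1 h2 := by obtain ⟨p, hp⟩ := h.above x h1 h2; exact ⟨p.swap, hp⟩

/-- Pigeonhole: otherwise the points of heights `1, …, x` have abscissas in `{1, …, x}`, hence fill
it, and leave no room there for a point higher than `x`. -/
theorem IsPermSet.exists_below {n : ℤ} {S : Set (ℤ × ℤ)} (h : IsPermSet n S) {x : ℤ} (hx : x ≤ n)
    (ha : ∃ p ∈ S, p.1 ≤ x ∧ x < p.2) : ∃ p ∈ S, p.2 ≤ x ∧ x < p.1 := by
  obtain ⟨p, hp, hp1, hp2⟩ := ha
  by_contra! hb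
  have hbp := h.bound p hp
  choose! g hg using h.surj_snd
  have hsub : (Finset.Icc 1 x).image g ⊆ Finset.Icc 1 x := by
    intro z hz
    obtain ⟨y, hy, rfl⟩ := Finset.mem_image.1 hz
    rw [Finset.mem_Icc] at hy ⊢
    exact ⟨(h.bound _ (hg y hy.1 (by omega))).1, hb _ (hg y hy.1 (by omega)) hy.2⟩
  have hinj : Set.InjOn g (Finset.Icc 1 x) := by
    intro y hy z hz e
    rw [Finset.coe_Icc, Set.mem_Icc] at hy hz
    exact congrArg Prod.snd
      (h.inj_fst _ (hg y hy.1 (by omega)) _ (hg z hz.1 (by omega)) e)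
  have heq := Finset.eq_of_subset_of_card_le hsub (Finset.card_image_of_injOn hinj).ge
  have hmem : p.1 ∈ (Finset.Icc 1 x).image g := by rw [heq, Finset.mem_Icc]; omega
  obtain ⟨y, hy, e⟩ := Finset.mem_image.1 hmem
  rw [Finset.mem_Icc] at hy
  have := congrArg Prod.snd (h.inj_fst _ (hg y hy.1 (by omega)) _ hp e)
  dsimp only at this
  omega

theorem IsPermSet.isIndec {n : ℤ} {S : Set (ℤ × ℤ)} (h : IsPermSet n S)
    (hx : ∀ x, 1 ≤ x → x < n →
      (∃ p ∈ S, p.1 ≤ x ∧ x < p.2) ∨ ∃ p ∈ S, p.2 ≤ x ∧ x < p.1) : IsIndec n S := by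
  have key : ∀ x, x < n → (∃ p ∈ S, p.2 ≤ x ∧ x < p.1) → ∃ p ∈ S, p.1 ≤ x ∧ x < p.2 := by
    rintro x h2 ⟨p, hp⟩
    obtain ⟨q, hq⟩ := h.transpose.exists_below h2.le ⟨p.swap, hp⟩
    exact ⟨q.swap, hq⟩
  exact ⟨fun x h1 h2 => (hx x h1 h2).elim id (key x h2),
    fun x h1 h2 => (hx x h1 h2).elim (h.exists_below h2.le) id⟩

/-! ### Quadrants of a point and the region bounded by a point set. -/

/-- Some point of `S` lies to the north-west of `p`. -/
def OccNW (S : Set (ℤ × ℤ)) (p : ℤ × ℤ) : Prop := ∃ q ∈ S, q.1 < p.1 ∧ p.2 < q.2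

/-- Some point of `S` lies to the south-east of `p`. -/
def OccSE (S : Set (ℤ × ℤ)) (p : ℤ × ℤ) : Prop := ∃ q ∈ S, p.1 < q.1 ∧ q.2 < p.2

/-- Some point of `S` lies to the north-east of `p`. -/
def OccNE (S : Set (ℤ × ℤ)) (p : ℤ × ℤ) : Prop := ∃ q ∈ S, p.1 < q.1 ∧ p.2 < q.2

/-- Every point has an empty north-west, south-east or north-east quadrant. -/
def ThreeFaced (S : Set (ℤ × ℤ)) : Prop := ∀ p ∈ S, OccNW S p → OccSE S p → ¬ OccNE S p

/-- Every point has an empty north-west or south-east quadrant. -/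
def TwoFaced (S : Set (ℤ × ℤ)) : Prop := ∀ p ∈ S, OccNW S p → ¬ OccSE S p

/-- The cell `c` lies below the staircase spanned by the points of `S`. -/
def Under (S : Set (ℤ × ℤ)) (c : ℤ × ℤ) : Prop := ∃ p ∈ S, p.1 ≤ c.1 ∧ c.2 < p.2

/-- The cell `c` lies above the staircase spanned by the points of `S`. -/
def Over (S : Set (ℤ × ℤ)) (c : ℤ × ℤ) : Prop := ∃ p ∈ S, c.1 < p.1 ∧ p.2 ≤ c.2

/-- The cell `c` lies to the north-east of a point of `S` which is neither on the upper nor on the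
lower staircase. -/
def Beyond (S : Set (ℤ × ℤ)) (c : ℤ × ℤ) : Prop :=
  ∃ p ∈ S, OccNW S p ∧ OccSE S p ∧ p.1 ≤ c.1 ∧ p.2 ≤ c.2

/-- The cells of the directed-convex permutomino with set of even vertices `S`. -/
def Region (S : Set (ℤ × ℤ)) (c : ℤ × ℤ) : Prop := Under S c ∧ Over S c ∧ ¬ Beyond S c

/-! ### Directed convex sets of cells -/

theorem IsConvex.col {P : Finset (ℤ × ℤ)} (h : IsConvex P) {x y₁ y y₂ : ℤ} (h₁ : (x, y₁) ∈ P)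
    (h₂ : (x, y₂) ∈ P) (hy₁ : y₁ ≤ y) (hy₂ : y ≤ y₂) : (x, y) ∈ P :=
  (h.1 x).out h₁ h₂ ⟨hy₁, hy₂⟩

theorem IsConvex.row {P : Finset (ℤ × ℤ)} (h : IsConvex P) {x₁ x x₂ y : ℤ} (h₁ : (x₁, y) ∈ P)
    (h₂ : (x₂, y) ∈ P) (hx₁ : x₁ ≤ x) (hx₂ : x ≤ x₂) : (x, y) ∈ P :=
  (h.2 y).out h₁ h₂ ⟨hx₁, hx₂⟩

section Directed

variable {P : Finset (ℤ × ℤ)} {r : ℤ × ℤ}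

theorem root_le {c : ℤ × ℤ}
    (h : Relation.ReflTransGen
      (fun a b : ℤ × ℤ => b ∈ P ∧ (b = (a.1 + 1, a.2) ∨ b = (a.1, a.2 + 1))) r c) :
    r.1 ≤ c.1 ∧ r.2 ≤ c.2 := by
  induction h with
  | refl => simp
  | tail _ h ih => rcases h.2 with h | h <;> subst h <;> constructor <;> dsimp only <;> omega

/-- A north-east path skips no row and never returns west, so it meets each row on its way weakly to
the left of its end. -/
theorem exists_mem_row {c : ℤ × ℤ} (hr : r ∈ P)
    (h : Relation.ReflTransGen
      (fun a b : ℤ × ℤ => b ∈ P ∧ (b = (a.1 + 1, a.2) ∨ b = (a.1, a.2 + 1))) r c)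
    (y : ℤ) (h₁ : r.2 ≤ y) (h₂ : y ≤ c.2) : ∃ x ≤ c.1, (x, y) ∈ P := by
  induction h with
  | refl =>
    obtain rfl : y = r.2 := le_antisymm h₂ h₁
    exact ⟨r.1, le_rfl, hr⟩
  | @tail b c _ h ih =>
    obtain ⟨hc, h | h⟩ := h <;> subst h
    · obtain ⟨x, hx, hxP⟩ := ih h₂
      exact ⟨x, by dsimp only; omega, hxP⟩
    · by_cases hy : y ≤ b.2
      · exact ih hy
      · obtain rfl : y = b.2 + 1 := by dsimp only at h₂; omega
        exact ⟨b.1, le_rfl, hc⟩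

/-- A directed convex set of cells is closed under componentwise minima. -/
theorem IsDirected.meet (hd : IsDirected P) (hc : IsConvex P) {x₁ x₂ y₁ y₂ : ℤ}
    (h₁ : (x₁, y₁) ∈ P) (h₂ : (x₂, y₂) ∈ P) (hx : x₁ ≤ x₂) (hy : y₂ ≤ y₁) : (x₁, y₂) ∈ P := by
  obtain ⟨r, hr, hP⟩ := hd
  obtain ⟨x, hx', hxP⟩ := exists_mem_row hr (hP _ h₁) y₂ (root_le (hP _ h₂)).2 hy
  exact hc.row hxP h₂ hx' hx

/-- The path from the root to `c` starts west of the quadrant with corner `(i, j)`. It enters it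
through column `i` or through row `j`, and convexity of that line fills the corner cell. -/
theorem IsDirected.reflex (hd : IsDirected P) (hc : IsConvex P) {i j : ℤ} {c : ℤ × ℤ}
    (h₁ : (i - 1, j) ∈ P) (h₂ : (i, j - 1) ∈ P) (hcP : c ∈ P) (hi : i ≤ c.1) (hj : j ≤ c.2) :
    (i, j) ∈ P := by
  obtain ⟨r, hr, hP⟩ := hd
  have hr1 := (root_le (hP _ h₁)).1
  have h := hP _ hcP
  clear hcP
  induction h with
  | refl => dsimp only at hr1; omega
  | @tail b c _ h ih =>
    obtain ⟨hcP, h | h⟩ := h <;> subst h <;> dsimp only at hi hj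
    · by_cases hb : i ≤ b.1
      · exact ih hb hj
      · obtain rfl : i = b.1 + 1 := by omega
        exact hc.col h₂ hcP (by omega) hj
    · by_cases hb : j ≤ b.2
      · exact ih hi hb
      · obtain rfl : j = b.2 + 1 := by omega
        exact hc.row h₁ hcP (by omega) hi

end Directed

/-! ### Following the boundary -/

theorem mem_evenVertices {P : Finset (ℤ × ℤ)} {x y : ℤ} : (x, y) ∈ evenVertices P ↔
    (((x, y - 1) ∈ P ∧ (x - 1, y - 1) ∉ P) ∨ ((x - 1, y) ∈ P ∧ (x, y) ∉ P)) ∧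
    (((x, y - 1) ∈ P ∧ (x, y) ∉ P) ∨ ((x - 1, y) ∈ P ∧ (x - 1, y - 1) ∉ P)) := by
  simp [evenVertices, NorthStep, SouthStep, EastStep, WestStep]

theorem mem_oddVertices {P : Finset (ℤ × ℤ)} {x y : ℤ} : (x, y) ∈ oddVertices P ↔
    (((x - 1, y - 1) ∈ P ∧ (x - 1, y) ∉ P) ∨ ((x, y) ∈ P ∧ (x, y - 1) ∉ P)) ∧
    (((x, y) ∈ P ∧ (x - 1, y) ∉ P) ∨ ((x - 1, y - 1) ∈ P ∧ (x, y - 1) ∉ P)) := by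
  simp [oddVertices, NorthStep, SouthStep, EastStep, WestStep]

/-- A property of integers which holds at `a` and fails somewhere above `a` has a last
point of validity. -/
theorem exists_last {p : ℤ → Prop} {a b : ℤ} (ha : p a) (hab : a ≤ b) (hb : ¬ p b) :
    ∃ h, a ≤ h ∧ h < b ∧ (∀ y, a ≤ y → y ≤ h → p y) ∧ ¬ p (h + 1) := by
  induction b, hab using Int.leInduction with
  | base => exact absurd ha hb
  | succ b hab ih =>
    by_cases hpb : ∀ y, a ≤ y → y ≤ b → p y
    · exact ⟨b, hab, by omega, hpb, hb⟩
    · push Not at hpb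
      obtain ⟨y, h1, h2, h3⟩ := hpb
      clear ih hb
      have : ∃ k : ℕ, ¬ p (a + k) := ⟨(y - a).toNat, by rwa [Int.toNat_of_nonneg (by omega), add_sub_cancel]⟩
      classical
      have hk := Nat.find_spec this
      have hmin := fun m => Nat.find_min this (m := m)
      have hle : Nat.find this ≤ (y - a).toNat :=
        Nat.find_min' this (by rwa [Int.toNat_of_nonneg (by omega), add_sub_cancel])
      set k := Nat.find this
      have hk0 : k ≠ 0 := by rintro h0; rw [h0] at hk; simp [ha] at hk
      refine ⟨a + k - 1, by omega, by omega, fun z hz1 hz2 => ?_, by rwa [sub_add_cancel]⟩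
      have := hmin (m := (z - a).toNat) (by omega)
      rw [Int.toNat_of_nonneg (by omega), add_sub_cancel] at this
      exact not_not.1 this

theorem exists_bound (P : Finset (ℤ × ℤ)) : ∃ N : ℤ, ∀ c ∈ P, |c.1| < N ∧ |c.2| < N := by
  refine ⟨(∑ c ∈ P, (|c.1| + |c.2|)) + 1, fun c hc => ?_⟩
  have := Finset.single_le_sum (f := fun c : ℤ × ℤ => |c.1| + |c.2|)
    (fun _ _ => by positivity) hc
  have h1 := abs_nonneg c.1
  have h2 := abs_nonneg c.2
  constructor <;> omega

/-- The vertical side through the cell's west edge is followed upwards; the vertex where it stops is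
entered vertically. -/
theorem exists_even_north {P : Finset (ℤ × ℤ)} {x y : ℤ} (h₁ : (x, y) ∈ P) (h₂ : (x - 1, y) ∉ P) :
    ∃ h > y, (x, h) ∈ evenVertices P := by
  obtain ⟨N, hN⟩ := exists_bound P
  have hy := abs_lt.1 (hN _ h₁).2
  obtain ⟨h, hyh, -, hh, hn⟩ := exists_last (p := fun z => (x, z) ∈ P ∧ (x - 1, z) ∉ P)
    (b := N) ⟨h₁, h₂⟩ hy.2.le (fun h => by have := abs_lt.1 (hN _ h.1).2; dsimp only at this; omega)
  refine ⟨h + 1, by omega, mem_evenVertices.2 ?_⟩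
  have := hh h hyh le_rfl
  rw [add_sub_cancel_right]
  tauto

theorem exists_even_south {P : Finset (ℤ × ℤ)} {x y : ℤ} (h₁ : (x - 1, y) ∈ P) (h₂ : (x, y) ∉ P) :
    ∃ h ≤ y, (x, h) ∈ evenVertices P ∧ ∀ z, h ≤ z → z ≤ y → (x - 1, z) ∈ P ∧ (x, z) ∉ P := by
  obtain ⟨N, hN⟩ := exists_bound P
  have hy := abs_lt.1 (hN _ h₁).2
  -- Ordinates are negated, so that the last point of validity is the lowest one.
  obtain ⟨h, hyh, -, hh, hn⟩ := exists_last (p := fun z => (x - 1, -z) ∈ P ∧ (x, -z) ∉ P)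
    (a := -y) (b := N) (by rw [neg_neg]; exact ⟨h₁, h₂⟩) (by dsimp only at hy; omega)
    (fun h => by have := abs_lt.1 (hN _ h.1).2; dsimp only at this; omega)
  refine ⟨-h, by omega, mem_evenVertices.2 ?_, fun z hz1 hz2 => ?_⟩
  · have := hh h hyh le_rfl
    rw [neg_add, ← sub_eq_add_neg] at hn
    tauto
  · simpa using hh (-z) (by omega) (by omega)

theorem exists_left_end {P : Finset (ℤ × ℤ)} {x y : ℤ} (h : (x, y) ∈ P) :
    ∃ z ≤ x, (z, y) ∈ P ∧ (z - 1, y) ∉ P := by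
  obtain ⟨N, hN⟩ := exists_bound P
  have hx := abs_lt.1 (hN _ h).1
  obtain ⟨z, hxz, -, hz, hn⟩ := exists_last (p := fun z => (-z, y) ∈ P) (a := -x)
    (b := N) (by rwa [neg_neg]) (by dsimp only at hx; omega)
    (fun h => by have := abs_lt.1 (hN _ h).1; dsimp only at this; omega)
  exact ⟨-z, by omega, hz z hxz le_rfl, by rwa [neg_add, ← sub_eq_add_neg] at hn⟩

theorem exists_right_end {P : Finset (ℤ × ℤ)} {x y : ℤ} (h : (x, y) ∈ P) :
    ∃ z > x, (z - 1, y) ∈ P ∧ (z, y) ∉ P := by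
  obtain ⟨N, hN⟩ := exists_bound P
  have hx := abs_lt.1 (hN _ h).1
  obtain ⟨z, hxz, -, hz, hn⟩ := exists_last (p := fun z => (z, y) ∈ P) (b := N) h hx.2.le
    (fun h => by have := abs_lt.1 (hN _ h).1; dsimp only at this; omega)
  exact ⟨z + 1, by omega, by rw [add_sub_cancel_right]; exact hz z hxz le_rfl, hn⟩

/-! ### From directed-convex sets of cells to permutations -/

/-- Going west to the end of a run of cells and then up along its side leads to an even vertex;
`over_of_mem` goes east and then down. -/
theorem under_of_mem {P : Finset (ℤ × ℤ)} {c : ℤ × ℤ} (h : c ∈ P) : Under (evenVertices P) c := by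
  obtain ⟨z, hz, h₁, h₂⟩ := exists_left_end h
  obtain ⟨k, hk, he⟩ := exists_even_north h₁ h₂
  exact ⟨_, he, hz, hk⟩

theorem over_of_mem {P : Finset (ℤ × ℤ)} {c : ℤ × ℤ} (h : c ∈ P) : Over (evenVertices P) c := by
  obtain ⟨z, hz, h₁, h₂⟩ := exists_right_end h
  obtain ⟨k, hk, he, -⟩ := exists_even_south h₁ h₂
  exact ⟨_, he, hz, hk⟩

/-- Every boundary vertex is a corner of a cell. -/
theorem exists_cell_of_even {P : Finset (ℤ × ℤ)} {p : ℤ × ℤ} (h : p ∈ evenVertices P) :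
    ∃ c ∈ P, p.1 - 1 ≤ c.1 ∧ c.1 ≤ p.1 ∧ p.2 - 1 ≤ c.2 ∧ c.2 ≤ p.2 := by
  obtain ⟨x, y⟩ := p
  obtain ⟨⟨h, -⟩ | ⟨h, -⟩, -⟩ := mem_evenVertices.1 h
  · exact ⟨_, h, by dsimp only; omega⟩
  · exact ⟨_, h, by dsimp only; omega⟩

section Forward

variable {P : Finset (ℤ × ℤ)}

/-- Cells near the two occluding vertices, combined with closure under minima, force the cell
south-west of `(x, y)` as soon as one of its neighbours at this vertex, `(x - 1, y)` or `(x, y -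
1)`, is present. Among the local patterns of an even vertex this leaves only the notch opening to
the north-east. -/
theorem reflex_of_occ (hc : IsConvex P) (hd : IsDirected P) {x y : ℤ}
    (h : (x, y) ∈ evenVertices P) (hNW : OccNW (evenVertices P) (x, y))
    (hSE : OccSE (evenVertices P) (x, y)) :
    (x - 1, y) ∈ P ∧ (x, y - 1) ∈ P ∧ (x, y) ∉ P := by
  obtain ⟨q, hq, hq1, hq2⟩ := hNW
  obtain ⟨⟨a, b⟩, ha, ha1, ha2, ha3, ha4⟩ := exists_cell_of_even hq
  obtain ⟨s, hs, hs1, hs2⟩ := hSE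
  obtain ⟨⟨a', b'⟩, hb, hb1, hb2, hb3, hb4⟩ := exists_cell_of_even hs
  dsimp only at *
  have h1 : (x, y - 1) ∈ P → (x - 1, y - 1) ∈ P := fun h' =>
    hc.row (hd.meet hc ha h' (by omega) (by omega)) h' (by omega) (by omega)
  have h2 : (x - 1, y) ∈ P → (x - 1, y - 1) ∈ P := fun h' =>
    hc.col (hd.meet hc h' hb (by omega) (by omega)) h' (by omega) (by omega)
  have := mem_evenVertices.1 h
  tauto

theorem not_mem_of_reflex (hc : IsConvex P) (hd : IsDirected P) {x y : ℤ}
    (h : (x, y) ∈ evenVertices P) (hNW : OccNW (evenVertices P) (x, y))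
    (hSE : OccSE (evenVertices P) (x, y)) {c : ℤ × ℤ} (h₁ : x ≤ c.1) (h₂ : y ≤ c.2) : c ∉ P := by
  obtain ⟨h3, h4, h5⟩ := reflex_of_occ hc hd h hNW hSE
  exact fun hcP => h5 (hd.reflex hc h3 h4 hcP h₁ h₂)

theorem threeFaced_evenVertices (hc : IsConvex P) (hd : IsDirected P) :
    ThreeFaced (evenVertices P) := by
  rintro ⟨x, y⟩ hp hNW hSE ⟨q, hq, hq1, hq2⟩
  obtain ⟨c, hcP, h⟩ := exists_cell_of_even hq
  dsimp only at *
  exact not_mem_of_reflex hc hd hp hNW hSE (by omega) (by omega) hcP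

theorem mem_iff_region (hc : IsConvex P) (hd : IsDirected P) (c : ℤ × ℤ) :
    c ∈ P ↔ Region (evenVertices P) c := by
  refine ⟨fun h => ⟨under_of_mem h, over_of_mem h, ?_⟩, ?_⟩
  · rintro ⟨p, hp, hNW, hSE, h₁, h₂⟩
    exact not_mem_of_reflex hc hd hp hNW hSE h₁ h₂ h
  · rintro ⟨⟨p, hp, hp1, hp2⟩, ⟨q, hq, hq1, hq2⟩, hB⟩
    by_contra hcP
    obtain ⟨x, y⟩ := c
    obtain ⟨⟨a, b⟩, ha, ha1, ha2, ha3, ha4⟩ := exists_cell_of_even hp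
    obtain ⟨⟨a', b'⟩, hb, hb1, hb2, hb3, hb4⟩ := exists_cell_of_even hq
    dsimp only at *
    -- The witnesses for `Under` and `Over` yield cells of `P` west of `c` in its row and south of
    -- `c` in its column.
    have hab := hd.meet hc ha hb (by omega) (by omega)
    have hl : (a, y) ∈ P := hc.col hab ha (by omega) (by omega)
    have hd' : (x, b') ∈ P := hc.row hab hb (by omega) (by omega)
    -- Walking west from the missing cell `c` to the first cell of `P`; its east edge has abscissa
    -- `-z`. The side through this edge is then followed down to an even vertex `(-z, k)`.
    obtain ⟨z, hz1, hz2, hz3, hz4⟩ := exists_last (p := fun z => (-z, y) ∉ P) (a := -x) (b := -a)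
      (by simpa using hcP) (by omega) (by simpa using hl)
    rw [not_not, neg_add, ← sub_eq_add_neg] at hz4
    obtain ⟨k, hk, he, hkz⟩ := exists_even_south hz4 (hz3 z hz1 le_rfl)
    -- The side stops above row `b'`, since that row contains cells on both sides of it and is
    -- connected.
    have hbk : b' < k := by
      by_contra hkb
      obtain ⟨h1, h2⟩ := hkz b' (by omega) (by omega)
      exact h2 (hc.row h1 hd' (by omega) (by omega))
    obtain ⟨h1, h2⟩ := hkz k le_rfl hk
    have h3 : (-z - 1, k - 1) ∈ P := hc.col (hd.meet hc h1 hd' (by omega) (by omega)) h1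
      (by omega) (by omega)
    have h4 : (-z, k - 1) ∈ P := by
      have := mem_evenVertices.1 he
      tauto
    -- The vertex reached is reflex: the two cells at the notch provide points to its north-west and
    -- south-east, so `c` is `Beyond`.
    obtain ⟨u, hu, hu1, hu2⟩ := under_of_mem h1
    obtain ⟨w, hw, hw1, hw2⟩ := over_of_mem h4
    dsimp only at *
    refine hB ⟨_, he, ⟨u, hu, ?_⟩, ⟨w, hw, ?_⟩, ?_, hk⟩ <;> dsimp only <;> omega

/-- One cell per column suffices: if it is on or above the diagonal, its upper witness crosses the
cut at `x`, otherwise its lower witness does. -/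
theorem isIndec_evenVertices {n : ℤ} (hS : IsPermSet n (evenVertices P))
    (hx : ∀ x, 1 ≤ x → x < n → ∃ y, (x, y) ∈ P) : IsIndec n (evenVertices P) := by
  refine hS.isIndec fun x h1 h2 => ?_
  obtain ⟨y, h⟩ := hx x h1 h2
  obtain ⟨p, hp, hp1, hp2⟩ := under_of_mem h
  obtain ⟨q, hq, hq1, hq2⟩ := over_of_mem h
  dsimp only at *
  by_cases hyx : x ≤ y
  · exact .inl ⟨p, hp, hp1, by omega⟩
  · exact .inr ⟨q, hq, by omega, hq1⟩

end Forward
/-! ### Connectedness -/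

/-- Two cells of `s` are connected inside `s`. -/
def Conn (s : Set (ℤ × ℤ)) (a b : ℤ × ℤ) : Prop :=
  ∃ (ha : a ∈ s) (hb : b ∈ s), (cellGraph.induce s).Reachable ⟨a, ha⟩ ⟨b, hb⟩

theorem Conn.symm {s : Set (ℤ × ℤ)} {a b : ℤ × ℤ} : Conn s a b → Conn s b a :=
  fun ⟨ha, hb, h⟩ => ⟨hb, ha, h.symm⟩

theorem Conn.trans {s : Set (ℤ × ℤ)} {a b c : ℤ × ℤ} : Conn s a b → Conn s b c → Conn s a c :=
  fun ⟨ha, _, h⟩ ⟨_, hc, h'⟩ => ⟨ha, hc, h.trans h'⟩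

theorem Conn.of_adj {s : Set (ℤ × ℤ)} {a b : ℤ × ℤ} (ha : a ∈ s) (hb : b ∈ s)
    (h : cellGraph.Adj a b) : Conn s a b :=
  ⟨ha, hb, SimpleGraph.Adj.reachable (G := cellGraph.induce s) (u := ⟨a, ha⟩) (v := ⟨b, hb⟩) h⟩

theorem preconnected_of_conn {s : Set (ℤ × ℤ)} {r : ℤ × ℤ} (h : ∀ c ∈ s, Conn s r c) :
    (cellGraph.induce s).Preconnected := by
  rintro ⟨a, ha⟩ ⟨b, hb⟩
  obtain ⟨_, _, h⟩ := (h a ha).symm.trans (h b hb)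
  exact h

theorem conn_segment {s : Set (ℤ × ℤ)} {f : ℤ → ℤ × ℤ}
    (hf : ∀ z, cellGraph.Adj (f z) (f (z + 1))) {a b : ℤ} (hab : a ≤ b)
    (h : ∀ z, a ≤ z → z ≤ b → f z ∈ s) : Conn s (f a) (f b) := by
  induction b, hab using Int.leInduction with
  | base => exact ⟨h a le_rfl le_rfl, h a le_rfl le_rfl, SimpleGraph.Reachable.refl _⟩
  | succ b hab ih =>
    exact (ih fun z h1 h2 => h z h1 (by omega)).trans
      (.of_adj (h b hab (by omega)) (h _ (by omega) le_rfl) (hf b))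

theorem cellGraph_adj_north (x z : ℤ) : cellGraph.Adj (x, z) (x, z + 1) := by
  simp [cellGraph]

theorem cellGraph_adj_east (y z : ℤ) : cellGraph.Adj (z, y) (z + 1, y) := by
  simp [cellGraph]

/-- Convexity of columns is enough: from a cell outside `P`, straight up or straight down there are
no cells of `P`, and everything far away is connected. -/
theorem IsConvex.holeFree {P : Finset (ℤ × ℤ)} (h : IsConvex P) : HoleFree P := by
  obtain ⟨N, hN⟩ := exists_bound P
  have out1 : ∀ x y, N ≤ |x| → (x, y) ∈ (P : Set (ℤ × ℤ))ᶜ := fun x y hx hP => by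
    have := (hN _ hP).1
    dsimp only at this
    omega
  have out2 : ∀ x y, N ≤ |y| → (x, y) ∈ (P : Set (ℤ × ℤ))ᶜ := fun x y hx hP => by
    have := (hN _ hP).2
    dsimp only at this
    omega
  have col : ∀ x y y', (∀ z, min y y' ≤ z → z ≤ max y y' → (x, z) ∈ (P : Set (ℤ × ℤ))ᶜ) →
      Conn (P : Set (ℤ × ℤ))ᶜ (x, y) (x, y') := by
    intro x y y' hz
    rcases le_total y y' with hy | hy
    · rw [min_eq_left hy, max_eq_right hy] at hz
      exact conn_segment (cellGraph_adj_north x) hy hz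
    · rw [min_eq_right hy, max_eq_left hy] at hz
      exact (conn_segment (cellGraph_adj_north x) hy hz).symm
  have row : ∀ y x x', N ≤ |y| → Conn (P : Set (ℤ × ℤ))ᶜ (x, y) (x', y) := by
    intro y x x' hy
    rcases le_total x x' with hx | hx
    · exact conn_segment (f := fun z => (z, y)) (cellGraph_adj_east y) hx fun z _ _ => out2 z y hy
    · exact (conn_segment (f := fun z => (z, y)) (cellGraph_adj_east y) hx
        fun z _ _ => out2 z y hy).symm
  have far : ∀ x y y', N ≤ |y'| → Conn (P : Set (ℤ × ℤ))ᶜ (x, y) (x, y') →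
      Conn (P : Set (ℤ × ℤ))ᶜ (N, N) (x, y) := by
    intro x y y' hy hc
    exact ((col N N y' fun z _ _ => out1 N z (le_abs_self N)).trans (row y' N x hy)).trans hc.symm
  refine preconnected_of_conn (r := (N, N)) ?_
  rintro ⟨x, y⟩ hc
  by_cases hup : ∃ z ≥ y, (x, z) ∈ P
  · obtain ⟨z, hz, hzP⟩ := hup
    have hlo : ∀ w ≤ y, (x, w) ∈ (P : Set (ℤ × ℤ))ᶜ := fun w hw hwP => hc (h.col hwP hzP hw hz)
    refine far x y (min y (-N)) ?_ (col x y _ fun w h1 h2 => hlo w ?_)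
    · have := neg_le_abs (min y (-N))
      omega
    · omega
  · push Not at hup
    refine far x y (max y N) ?_ (col x y _ fun w h1 h2 => hup w ?_)
    · have := le_abs_self (max y N)
      omega
    · omega

theorem IsDirected.isPolyomino {P : Finset (ℤ × ℤ)} (h : IsDirected P) : IsPolyomino P := by
  obtain ⟨r, hr, hP⟩ := h
  refine ⟨⟨r, hr⟩, preconnected_of_conn (r := r) fun c hc => ?_⟩
  have hrc := hP c hc
  clear hc
  induction hrc with
  | refl => exact ⟨hr, hr, SimpleGraph.Reachable.refl _⟩
  | @tail a b hab h ih =>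
    have ha : a ∈ P := ih.2.1
    obtain ⟨hb, h | h⟩ := h
    · exact ih.trans (.of_adj ha hb (h ▸ cellGraph_adj_east a.2 a.1))
    · exact ih.trans (.of_adj ha hb (h ▸ cellGraph_adj_north a.1 a.2))

/-- A set of cells is directed when all its cells other than the root have a western or southern
neighbour in it. -/
theorem isDirected_of_pred {P : Finset (ℤ × ℤ)} {r : ℤ × ℤ} (hne : P.Nonempty)
    (hpos : ∀ c ∈ P, 1 ≤ c.1 ∧ 1 ≤ c.2)
    (h : ∀ c ∈ P, c = r ∨ (c.1 - 1, c.2) ∈ P ∨ (c.1, c.2 - 1) ∈ P) : IsDirected P := by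
  have key : ∀ k : ℕ, ∀ c ∈ P, (c.1 + c.2).toNat = k → r ∈ P ∧ Relation.ReflTransGen
      (fun a b : ℤ × ℤ => b ∈ P ∧ (b = (a.1 + 1, a.2) ∨ b = (a.1, a.2 + 1))) r c := by
    intro k
    induction k using Nat.strong_induction_on with
    | _ k ih =>
      intro c hc hk
      rcases h c hc with rfl | h | h
      · exact ⟨hc, .refl⟩
      · have h1 := hpos _ h
        dsimp only at h1
        obtain ⟨hr, hrc⟩ := ih (c.1 - 1 + c.2).toNat (by omega) _ h rfl
        exact ⟨hr, hrc.tail ⟨hc, .inl (by simp)⟩⟩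
      · have h1 := hpos _ h
        dsimp only at h1
        obtain ⟨hr, hrc⟩ := ih (c.1 + (c.2 - 1)).toNat (by omega) _ h rfl
        exact ⟨hr, hrc.tail ⟨hc, .inr (by simp)⟩⟩
  obtain ⟨c, hc⟩ := hne
  exact ⟨r, (key _ c hc rfl).1, fun c hc => (key _ c hc rfl).2⟩

/-! ### Permutation sets and permutations -/

theorem IsPermSet.exists_represents {m : ℕ} {V : Set (ℤ × ℤ)} (h : IsPermSet m V) :
    ∃ π : Equiv.Perm (Fin m), Represents V π := by
  have h1 : ∀ i : Fin m, ∃ j : Fin m, (((i : ℕ) : ℤ) + 1, ((j : ℕ) : ℤ) + 1) ∈ V := by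
    intro i
    obtain ⟨y, hy⟩ := h.surj_fst ((i : ℕ) + 1) (by omega) (by omega)
    have := h.bound _ hy
    dsimp only at this
    refine ⟨⟨(y - 1).toNat, by omega⟩, ?_⟩
    have e : (((y - 1).toNat : ℕ) : ℤ) + 1 = y := by omega
    rwa [e]
  choose f hf using h1
  have hinj : Function.Injective f := fun i j hij => by
    have := congrArg Prod.fst (h.inj_snd _ (hf i) _ (hf j) (by rw [hij]))
    dsimp only at this
    omega
  refine ⟨Equiv.ofBijective f (Finite.injective_iff_bijective.1 hinj), ?_⟩
  ext p
  refine ⟨fun hp => ?_, ?_⟩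
  · have := h.bound p hp
    refine ⟨⟨(p.1 - 1).toNat, by omega⟩, h.inj_fst _ (hf _) _ hp ?_⟩
    dsimp only
    omega
  · rintro ⟨i, rfl⟩
    exact hf i

theorem isPermSet_range {m : ℕ} (π : Equiv.Perm (Fin m)) :
    IsPermSet m (Set.range fun i : Fin m => (((i : ℕ) : ℤ) + 1, ((π i : ℕ) : ℤ) + 1)) where
  bound := by
    rintro _ ⟨i, rfl⟩
    dsimp only
    omega
  inj_fst := by
    rintro _ ⟨i, rfl⟩ _ ⟨j, rfl⟩ h
    obtain rfl : i = j := by dsimp only at h; omega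
    rfl
  inj_snd := by
    rintro _ ⟨i, rfl⟩ _ ⟨j, rfl⟩ h
    obtain rfl : i = j := π.injective (by dsimp only at h; omega)
    rfl
  surj_fst x h1 h2 := by
    refine ⟨_, ⟨⟨(x - 1).toNat, by omega⟩, Prod.ext ?_ rfl⟩⟩
    dsimp only
    omega
  surj_snd y h1 h2 := by
    refine ⟨_, ⟨π.symm ⟨(y - 1).toNat, by omega⟩, Prod.ext rfl ?_⟩⟩
    simp only [Equiv.apply_symm_apply]
    omega

/-! ### The other vertices -/

/-- The condition on cells that defines the vertices entered vertically. -/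
def EvenAt (Q : ℤ → ℤ → Prop) (x y : ℤ) : Prop :=
  ((Q x (y - 1) ∧ ¬ Q (x - 1) (y - 1)) ∨ (Q (x - 1) y ∧ ¬ Q x y)) ∧
    ((Q x (y - 1) ∧ ¬ Q x y) ∨ (Q (x - 1) y ∧ ¬ Q (x - 1) (y - 1)))

/-- The condition on cells that defines the vertices entered horizontally. -/
def OddAt (Q : ℤ → ℤ → Prop) (x y : ℤ) : Prop :=
  ((Q (x - 1) (y - 1) ∧ ¬ Q (x - 1) y) ∨ (Q x y ∧ ¬ Q x (y - 1))) ∧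
    ((Q x y ∧ ¬ Q (x - 1) y) ∨ (Q (x - 1) (y - 1) ∧ ¬ Q x (y - 1)))

theorem sum_sub_pred (g : ℤ → ℤ) (n : ℕ) :
    ∑ x ∈ Finset.Icc (1 : ℤ) n, (g x - g (x - 1)) = g n - g 0 := by
  induction n with
  | zero => simp
  | succ n ih =>
    have : Finset.Icc (1 : ℤ) (n + 1 : ℕ) = insert ((n + 1 : ℕ) : ℤ) (Finset.Icc (1 : ℤ) n) := by
      ext x
      simp only [Finset.mem_Icc, Finset.mem_insert]
      omega
    rw [this, Finset.sum_insert (by simp), ih]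
    push_cast
    rw [add_sub_cancel_right]
    ring

/-- If each row contains a single vertex entered vertically, then each row contains a
single vertex entered horizontally. -/
theorem existsUnique_oddAt {Q : ℤ → ℤ → Prop} {n : ℕ}
    (hQ : ∀ x y, Q x y → 1 ≤ x ∧ x < n)
    (h₁ : ∀ x y, Q (x - 1) y → Q x (y - 1) → Q (x - 1) (y - 1) ∨ Q x y)
    (h₂ : ∀ x y, Q (x - 1) (y - 1) → Q x y → Q (x - 1) y ∨ Q x (y - 1))
    {y : ℤ} (he : ∃! x, EvenAt Q x y) : ∃! x, OddAt Q x y := by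
  classical
  -- The mixed second difference of the indicator of `Q` is `+1` at an odd vertex, `-1` at an even
  -- one and `0` elsewhere; `h₁` and `h₂` exclude the two diagonal patterns, where it would be `±2`.
  have hpt : ∀ x, (((if Q x y then 1 else 0) - (if Q x (y - 1) then 1 else 0)) -
      ((if Q (x - 1) y then 1 else 0) - (if Q (x - 1) (y - 1) then 1 else 0)) : ℤ) =
      (if OddAt Q x y then 1 else 0) - (if EvenAt Q x y then 1 else 0) := by
    intro x
    have h1 := h₁ x y
    have h2 := h₂ x y
    unfold OddAt EvenAt
    by_cases a : Q x y <;> by_cases b : Q x (y - 1) <;> by_cases c : Q (x - 1) y <;>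
      by_cases d : Q (x - 1) (y - 1) <;> simp_all
  -- Summed along the row it telescopes to zero, since columns `0` and `n` are empty; hence there
  -- are as many odd vertices as even ones.
  have hsum := sum_sub_pred
    (fun x => (if Q x y then 1 else 0) - (if Q x (y - 1) then 1 else 0)) n
  have hout : ∀ y, ¬ Q n y ∧ ¬ Q 0 y := fun y =>
    ⟨fun h => by have := hQ _ _ h; omega, fun h => by have := hQ _ _ h; omega⟩
  simp only [hout, if_false, hpt, sub_zero, Finset.sum_sub_distrib] at hsum
  have hEb : ∀ x, EvenAt Q x y → x ∈ Finset.Icc (1 : ℤ) n := by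
    rintro x ⟨⟨h, -⟩ | ⟨h, -⟩, -⟩ <;> have := hQ _ _ h <;> rw [Finset.mem_Icc] <;> omega
  have hOb : ∀ x, OddAt Q x y → x ∈ Finset.Icc (1 : ℤ) n := by
    rintro x ⟨⟨h, -⟩ | ⟨h, -⟩, -⟩ <;> have := hQ _ _ h <;> rw [Finset.mem_Icc] <;> omega
  rw [Finset.sum_boole, Finset.sum_boole] at hsum
  have hE : (Finset.filter (fun x => EvenAt Q x y) (Finset.Icc (1 : ℤ) n)).card = 1 := by
    obtain ⟨x, hx, hu⟩ := he
    refine Finset.card_eq_one.2 ⟨x, ?_⟩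
    ext z
    simp only [Finset.mem_filter, Finset.mem_singleton]
    exact ⟨fun h => hu z h.2, fun h => h ▸ ⟨hEb x hx, hx⟩⟩
  have hO : (Finset.filter (fun x => OddAt Q x y) (Finset.Icc (1 : ℤ) n)).card = 1 := by
    omega
  obtain ⟨x, hx⟩ := Finset.card_eq_one.1 hO
  have hmem : ∀ z, OddAt Q z y ↔ z = x := fun z => by
    rw [← Finset.mem_singleton, ← hx, Finset.mem_filter]
    exact ⟨fun h => ⟨hOb z h, h⟩, And.right⟩
  exact ⟨x, (hmem x).2 rfl, fun z hz => (hmem z).1 hz⟩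

theorem isPermSet_oddVertices {P : Finset (ℤ × ℤ)} {n : ℕ} (hS : IsPermSet n (evenVertices P))
    (hP : ∀ x y, (x, y) ∈ P → 1 ≤ x ∧ x < n ∧ 1 ≤ y ∧ y < n)
    (h₁ : ∀ x y, (x - 1, y) ∈ P → (x, y - 1) ∈ P → (x - 1, y - 1) ∈ P ∨ (x, y) ∈ P)
    (h₂ : ∀ x y, (x - 1, y - 1) ∈ P → (x, y) ∈ P → (x - 1, y) ∈ P ∨ (x, y - 1) ∈ P) :
    IsPermSet n (oddVertices P) := by
  have hrow : ∀ y : ℤ, 1 ≤ y → y ≤ n → ∃! x, (x, y) ∈ oddVertices P := by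
    intro y hy1 hy2
    have := existsUnique_oddAt (Q := fun x y => (x, y) ∈ P) (n := n) (y := y)
      (fun x y h => ⟨(hP x y h).1, (hP x y h).2.1⟩) h₁ h₂ (by
        obtain ⟨x, hx⟩ := hS.surj_snd y hy1 hy2
        exact ⟨x, mem_evenVertices.1 hx, fun z hz => congrArg Prod.fst
          (hS.inj_snd (z, y) (mem_evenVertices.2 hz) _ hx rfl)⟩)
    exact (existsUnique_congr fun z => mem_oddVertices.symm).1 this
  have hcol : ∀ x : ℤ, 1 ≤ x → x ≤ n → ∃! y, (x, y) ∈ oddVertices P := by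
    intro x hx1 hx2
    -- Reflection in the diagonal preserves both kinds of vertices, so columns reduce to rows.
    have := existsUnique_oddAt (Q := fun y x => (x, y) ∈ P) (n := n) (y := x)
      (fun y x h => ⟨(hP x y h).2.2.1, (hP x y h).2.2.2⟩)
      (fun y x h h' => h₁ x y h' h) (fun y x h h' => (h₂ x y h h').symm) (by
        obtain ⟨y, hy⟩ := hS.surj_fst x hx1 hx2
        have hiff : ∀ z, EvenAt (fun y x => (x, y) ∈ P) z x ↔ (x, z) ∈ evenVertices P := fun z => by
          rw [mem_evenVertices]
          unfold EvenAt
          tauto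
        exact ⟨y, (hiff y).2 hy, fun z hz => congrArg Prod.snd
          (hS.inj_fst (x, z) ((hiff z).1 hz) _ hy rfl)⟩)
    refine (existsUnique_congr fun z => ?_).1 this
    rw [mem_oddVertices]
    unfold OddAt
    tauto
  have hb : ∀ p ∈ oddVertices P, 1 ≤ p.1 ∧ p.1 ≤ n ∧ 1 ≤ p.2 ∧ p.2 ≤ n := by
    rintro ⟨x, y⟩ h
    obtain ⟨⟨h, -⟩ | ⟨h, -⟩, -⟩ := mem_oddVertices.1 h <;> have := hP _ _ h <;> dsimp only <;> omega
  refine ⟨hb, ?_, ?_, fun x h1 h2 => (hcol x h1 h2).exists, fun y h1 h2 => (hrow y h1 h2).exists⟩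
  · rintro ⟨x, y⟩ hp ⟨x', y'⟩ hq (rfl : x = x')
    have := hb _ hp
    rw [(hcol x this.1 this.2.1).unique hp hq]
  · rintro ⟨x, y⟩ hp ⟨x', y'⟩ hq (rfl : y = y')
    have := hb _ hp
    rw [(hrow y this.2.2.1 this.2.2.2).unique hp hq]

/-! ### The region of a three-faced permutation -/

theorem occNW_transpose {S : Set (ℤ × ℤ)} {x y : ℤ} :
    OccNW (transpose S) (y, x) ↔ OccSE S (x, y) :=
  ⟨fun ⟨q, hq, h⟩ => ⟨q.swap, hq, h.2, h.1⟩, fun ⟨q, hq, h⟩ => ⟨q.swap, hq, h.2, h.1⟩⟩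

theorem occSE_transpose {S : Set (ℤ × ℤ)} {x y : ℤ} :
    OccSE (transpose S) (y, x) ↔ OccNW S (x, y) :=
  ⟨fun ⟨q, hq, h⟩ => ⟨q.swap, hq, h.2, h.1⟩, fun ⟨q, hq, h⟩ => ⟨q.swap, hq, h.2, h.1⟩⟩

theorem occNE_transpose {S : Set (ℤ × ℤ)} {x y : ℤ} :
    OccNE (transpose S) (y, x) ↔ OccNE S (x, y) :=
  ⟨fun ⟨q, hq, h⟩ => ⟨q.swap, hq, h.2, h.1⟩, fun ⟨q, hq, h⟩ => ⟨q.swap, hq, h.2, h.1⟩⟩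

theorem ThreeFaced.transpose {S : Set (ℤ × ℤ)} (h : ThreeFaced S) : ThreeFaced (transpose S) :=
  fun p hp h1 h2 h3 => h (p.2, p.1) hp (occSE_transpose.1 h2) (occNW_transpose.1 h1)
    (occNE_transpose.1 h3)

theorem under_transpose {S : Set (ℤ × ℤ)} {x y : ℤ} :
    Under (transpose S) (y, x) ↔ Over S (x, y) :=
  ⟨fun ⟨q, hq, h⟩ => ⟨q.swap, hq, h.2, h.1⟩, fun ⟨q, hq, h⟩ => ⟨q.swap, hq, h.2, h.1⟩⟩

theorem over_transpose {S : Set (ℤ × ℤ)} {x y : ℤ} :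
    Over (transpose S) (y, x) ↔ Under S (x, y) :=
  ⟨fun ⟨q, hq, h⟩ => ⟨q.swap, hq, h.2, h.1⟩, fun ⟨q, hq, h⟩ => ⟨q.swap, hq, h.2, h.1⟩⟩

theorem beyond_transpose {S : Set (ℤ × ℤ)} {x y : ℤ} :
    Beyond (transpose S) (y, x) ↔ Beyond S (x, y) :=
  ⟨fun ⟨q, hq, h1, h2, h3, h4⟩ =>
    ⟨q.swap, hq, occSE_transpose.1 h2, occNW_transpose.1 h1, h4, h3⟩,
   fun ⟨q, hq, h1, h2, h3, h4⟩ =>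
    ⟨q.swap, hq, occNW_transpose.2 h2, occSE_transpose.2 h1, h4, h3⟩⟩

theorem region_transpose {S : Set (ℤ × ℤ)} {x y : ℤ} :
    Region (transpose S) (y, x) ↔ Region S (x, y) := by
  unfold Region
  rw [under_transpose, over_transpose, beyond_transpose]
  tauto

section Backward

variable {n : ℤ} {S : Set (ℤ × ℤ)}

theorem Region.bound (hS : IsPermSet n S) {x y : ℤ} (h : Region S (x, y)) :
    1 ≤ x ∧ x < n ∧ 1 ≤ y ∧ y < n := by
  obtain ⟨⟨p, hp, hp1, hp2⟩, ⟨q, hq, hq1, hq2⟩, -⟩ := h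
  have := hS.bound p hp
  have := hS.bound q hq
  dsimp only at *
  omega

theorem Region.col {x y₁ y y₂ : ℤ} (h₁ : Region S (x, y₁)) (h₂ : Region S (x, y₂)) (hy₁ : y₁ ≤ y)
    (hy₂ : y ≤ y₂) : Region S (x, y) := by
  obtain ⟨-, ⟨q, hq, hq1, hq2⟩, -⟩ := h₁
  obtain ⟨⟨p, hp, hp1, hp2⟩, -, hB⟩ := h₂
  dsimp only at *
  exact ⟨⟨p, hp, hp1, by dsimp only; omega⟩, ⟨q, hq, hq1, by dsimp only; omega⟩,
    fun ⟨b, hb, h1, h2, h3, h4⟩ => hB ⟨b, hb, h1, h2, h3, by dsimp only at *; omega⟩⟩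

theorem Region.row {x₁ x x₂ y : ℤ} (h₁ : Region S (x₁, y)) (h₂ : Region S (x₂, y)) (hx₁ : x₁ ≤ x)
    (hx₂ : x ≤ x₂) : Region S (x, y) :=
  region_transpose.1 (Region.col (region_transpose.2 h₁) (region_transpose.2 h₂) hx₁ hx₂)

theorem isConvex_of_region {P : Finset (ℤ × ℤ)} (hP : ∀ c, c ∈ P ↔ Region S c) : IsConvex P := by
  constructor
  · refine fun x => ⟨fun y₁ h₁ y₂ h₂ y hy => ?_⟩
    exact (hP _).2 (Region.col ((hP _).1 h₁) ((hP _).1 h₂) hy.1 hy.2)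
  · refine fun x => ⟨fun y₁ h₁ y₂ h₂ y hy => ?_⟩
    exact (hP _).2 (Region.row ((hP _).1 h₁) ((hP _).1 h₂) hy.1 hy.2)

/-- The cell is taken at the height of the lowest point strictly to the right of `x`. A reflex point
hiding it would have that point to its north-east, against `ThreeFaced`. -/
theorem exists_region_col (hS : IsPermSet n S) (hI : IsIndec n S) (hT : ThreeFaced S) {x : ℤ}
    (h₁ : 1 ≤ x) (h₂ : x < n) : ∃ y, Region S (x, y) := by
  obtain ⟨q, hq, hq1, hq2⟩ := hI.below x h₁ h₂
  obtain ⟨u, hu, hu1, hu2⟩ := hI.above x h₁ h₂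
  obtain ⟨y, ⟨p, hp, hp1, rfl⟩, hmin⟩ := Int.exists_least_of_bdd
    (P := fun y => ∃ p ∈ S, x < p.1 ∧ p.2 = y)
    ⟨1, by rintro _ ⟨p, hp, -, rfl⟩; exact (hS.bound p hp).2.2.1⟩ ⟨_, q, hq, hq2, rfl⟩
  have hle := hmin _ ⟨q, hq, hq2, rfl⟩
  refine ⟨p.2, ⟨u, hu, hu1, by dsimp only; omega⟩, ⟨p, hp, hp1, le_rfl⟩, ?_⟩
  rintro ⟨b, hb, hNW, hSE, hb1, hb2⟩
  dsimp only at hb1 hb2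
  refine hT b hb hNW hSE ⟨p, hp, by omega, lt_of_le_of_ne hb2 fun e => ?_⟩
  rw [hS.inj_snd b hb p hp e] at hb1
  omega

theorem exists_region_row (hS : IsPermSet n S) (hI : IsIndec n S) (hT : ThreeFaced S) {y : ℤ}
    (h₁ : 1 ≤ y) (h₂ : y < n) : ∃ x, Region S (x, y) := by
  obtain ⟨x, hx⟩ := exists_region_col hS.transpose hI.transpose hT.transpose h₁ h₂
  exact ⟨x, region_transpose.1 hx⟩

/-- A step west can only violate `Under`, and a step south only `Over`. If both fail, the points
left of `x` are at height at most `y` and those right of `x` at height at least `y`;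
indecomposability then forces `x = y = 1`. -/
theorem Region.pred (hS : IsPermSet n S) (hI : IsIndec n S) {x y : ℤ} (h : Region S (x, y)) :
    (x, y) = (1, 1) ∨ Region S (x - 1, y) ∨ Region S (x, y - 1) := by
  have hb := h.bound hS
  obtain ⟨⟨p, hp, hp1, hp2⟩, ⟨q, hq, hq1, hq2⟩, hB⟩ := h
  dsimp only at hp1 hp2 hq1 hq2
  by_contra! hcon
  obtain ⟨hne, hx, hy⟩ := hcon
  have hU : ∀ p ∈ S, p.1 < x → p.2 ≤ y := by
    intro p hp h1
    by_contra! h2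
    refine hx ⟨⟨p, hp, by dsimp only; omega, h2⟩, ⟨q, hq, by dsimp only; omega, hq2⟩, ?_⟩
    rintro ⟨b, hb, h1, h2, h3, h4⟩
    exact hB ⟨b, hb, h1, h2, by dsimp only at *; omega, h4⟩
  have hL : ∀ p ∈ S, x < p.1 → y ≤ p.2 := by
    intro q hq h1
    by_contra! h2
    refine hy ⟨⟨p, hp, hp1, by dsimp only; omega⟩, ⟨q, hq, h1, by dsimp only; omega⟩, ?_⟩
    rintro ⟨b, hb, h1, h2, h3, h4⟩
    exact hB ⟨b, hb, h1, h2, h3, by dsimp only at *; omega⟩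
  have hqy : q.2 = y := le_antisymm hq2 (hL q hq hq1)
  have hpx : p.1 = x := by
    by_contra hne
    have := hU p hp (by omega)
    omega
  have hxy : x ≤ y := by
    by_contra! hlt
    obtain ⟨s, hs, hs1, hs2⟩ := hI.above (x - 1) (by omega) (by omega)
    have := hU s hs (by omega)
    omega
  have hyx : y ≤ x := by
    by_contra! hlt
    obtain ⟨s, hs, hs1, hs2⟩ := hI.below (y - 1) (by omega) (by omega)
    have := hL s hs (by omega)
    omega
  obtain rfl : x = y := le_antisymm hxy hyx
  rcases eq_or_ne x 1 with rfl | hx1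
  · exact hne rfl
  · obtain ⟨s, hs, hs1, hs2⟩ := hI.above (x - 1) (by omega) (by omega)
    have := hU s hs (by omega)
    have := congrArg Prod.fst (hS.inj_snd s hs q hq (by omega))
    omega

theorem isDirected_of_region (hS : IsPermSet n S) (hI : IsIndec n S) {P : Finset (ℤ × ℤ)}
    (hne : P.Nonempty) (hP : ∀ c, c ∈ P ↔ Region S c) : IsDirected P := by
  refine isDirected_of_pred (r := (1, 1)) hne (fun c hc => ?_) fun c hc => ?_
  · have := ((hP _).1 hc).bound hS
    exact ⟨this.1, this.2.2.1⟩
  · rw [hP, hP]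
    exact ((hP _).1 hc).pred hS hI

/-! ### The even vertices of the region are the points of the set. -/

theorem region_south_of_occSE (hS : IsPermSet n S) (hT : ThreeFaced S) {x y : ℤ}
    (h : (x, y) ∈ S) (hSE : OccSE S (x, y)) : Region S (x, y - 1) := by
  obtain ⟨q, hq, hq1, hq2⟩ := hSE
  dsimp only at hq1 hq2
  refine ⟨⟨_, h, le_rfl, by dsimp only; omega⟩, ⟨q, hq, hq1, by dsimp only; omega⟩, ?_⟩
  rintro ⟨b, hb, hb1, hb2, hb3, hb4⟩
  dsimp only at hb3 hb4
  refine hT b hb hb1 hb2 ⟨_, h, lt_of_le_of_ne hb3 fun e => ?_, by dsimp only; omega⟩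
  have := congrArg Prod.snd (hS.inj_fst b hb _ h e)
  dsimp only at this
  omega

theorem region_west_of_occNW (hS : IsPermSet n S) (hT : ThreeFaced S) {x y : ℤ}
    (h : (x, y) ∈ S) (hNW : OccNW S (x, y)) : Region S (x - 1, y) :=
  region_transpose.1 (region_south_of_occSE hS.transpose hT.transpose (mem_transpose.2 h)
    (occSE_transpose.2 hNW))

/-- With both quadrants empty, everything to the left is lower and everything to the right is
higher, which contradicts indecomposability at a cut next to the point. -/
theorem occ_of_isIndec (hS : IsPermSet n S) (hI : IsIndec n S) (hn : 2 ≤ n) {x y : ℤ}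
    (h : (x, y) ∈ S) : OccNW S (x, y) ∨ OccSE S (x, y) := by
  by_contra! hcon
  obtain ⟨hNW, hSE⟩ := hcon
  have hb := hS.bound _ h
  dsimp only at hb
  have h1 : ∀ p ∈ S, p.1 < x → p.2 < y := by
    intro p hp hpx
    refine lt_of_not_ge fun hge => hNW ⟨p, hp, hpx, lt_of_le_of_ne hge fun e => ?_⟩
    have := congrArg Prod.fst (hS.inj_snd _ h p hp e)
    dsimp only at this
    omega
  have h2 : ∀ p ∈ S, x < p.1 → y < p.2 := by
    intro p hp hpx
    refine lt_of_not_ge fun hge => hSE ⟨p, hp, hpx, lt_of_le_of_ne hge fun e => ?_⟩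
    have := congrArg Prod.fst (hS.inj_snd _ h p hp e.symm)
    dsimp only at this
    omega
  have hx : ∀ p ∈ S, p.1 = x → p.2 = y := fun p hp e => congrArg Prod.snd (hS.inj_fst p hp _ h e)
  by_cases hyx : y ≤ x
  · rcases eq_or_ne x n with rfl | hxn
    · rcases eq_or_ne y 1 with rfl | hy1
      · obtain ⟨s, hs, hs1, hs2⟩ := hI.above 1 le_rfl (by omega)
        have := h1 s hs (by omega)
        omega
      · obtain ⟨s, hs, hs1, hs2⟩ := hI.above (x - 1) (by omega) (by omega)
        have := h1 s hs (by omega)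
        omega
    · obtain ⟨s, hs, hs1, hs2⟩ := hI.above x (by omega) (by omega)
      rcases eq_or_ne s.1 x with e | e
      · have := hx s hs e
        omega
      · have := h1 s hs (by omega)
        omega
  · obtain ⟨s, hs, hs1, hs2⟩ := hI.below (y - 1) (by omega) (by omega)
    rcases eq_or_ne s.1 x with e | e
    · have := hx s hs e
      omega
    · have := h2 s hs (by omega)
      omega

theorem not_region_of_not_occNW (hS : IsPermSet n S) {x y : ℤ} (h : (x, y) ∈ S)
    (hNW : ¬ OccNW S (x, y)) : ¬ Region S (x - 1, y - 1) ∧ ¬ Region S (x, y) := by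
  constructor
  · rintro ⟨⟨p, hp, hp1, hp2⟩, -, -⟩
    dsimp only at hp1 hp2
    refine hNW ⟨p, hp, by dsimp only; omega, lt_of_le_of_ne (by dsimp only; omega) fun e => ?_⟩
    have := congrArg Prod.fst (hS.inj_snd _ h p hp e)
    dsimp only at this
    omega
  · rintro ⟨⟨p, hp, hp1, hp2⟩, -, -⟩
    dsimp only at hp1 hp2
    refine hNW ⟨p, hp, lt_of_le_of_ne hp1 fun e => ?_, hp2⟩
    have := congrArg Prod.snd (hS.inj_fst _ h p hp e.symm)
    dsimp only at this
    omega

theorem not_region_of_not_occSE (hS : IsPermSet n S) {x y : ℤ} (h : (x, y) ∈ S)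
    (hSE : ¬ OccSE S (x, y)) : ¬ Region S (x - 1, y - 1) ∧ ¬ Region S (x, y) := by
  have := not_region_of_not_occNW hS.transpose (mem_transpose.2 h) (mt occNW_transpose.1 hSE)
  rwa [region_transpose, region_transpose] at this

/-- An L-shaped configuration that opens to the south-west does not occur. -/
theorem region_of_diagonal {x y : ℤ} (h₁ : Region S (x - 1, y)) (h₂ : Region S (x, y - 1)) :
    Region S (x - 1, y - 1) := by
  obtain ⟨⟨p, hp, hp1, hp2⟩, -, hB⟩ := h₁
  obtain ⟨-, ⟨q, hq, hq1, hq2⟩, -⟩ := h₂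
  dsimp only at *
  exact ⟨⟨p, hp, hp1, by dsimp only; omega⟩, ⟨q, hq, by dsimp only; omega, hq2⟩,
    fun ⟨b, hb, h1, h2, h3, h4⟩ => hB ⟨b, hb, h1, h2, h3, by dsimp only at *; omega⟩⟩

/-- The west cell is missing only because all points left of `x` are below `y`, so the upper witness
has abscissa `x`. If it is higher than `y`, the cell `(x, y)` can be missing only through a reflex
point, which must be `(x, y)` itself. -/
theorem mem_of_upper_corner (hS : IsPermSet n S) {x y : ℤ}
    (h₁ : Region S (x, y - 1)) (h₂ : ¬ Region S (x - 1, y - 1)) (h₃ : ¬ Region S (x, y)) :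
    (x, y) ∈ S := by
  have hb := h₁.bound hS
  obtain ⟨⟨p, hp, hp1, hp2⟩, ⟨q, hq, hq1, hq2⟩, hB⟩ := h₁
  dsimp only at hp1 hp2 hq1 hq2
  have h4 : ∀ s ∈ S, s.1 < x → s.2 < y := by
    intro s hs hs1
    by_contra! hs2
    refine h₂ ⟨⟨s, hs, by dsimp only; omega, by dsimp only; omega⟩,
      ⟨q, hq, by dsimp only; omega, hq2⟩, ?_⟩
    rintro ⟨b, hb, h1, h2, h3, h4⟩
    exact hB ⟨b, hb, h1, h2, by dsimp only at *; omega, h4⟩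
  have hpx : p.1 = x := by
    by_contra hne
    have := h4 p hp (by omega)
    omega
  by_contra hxy
  have hpy : p.2 ≠ y := fun e => hxy (by rwa [← hpx, ← e])
  refine h₃ ⟨⟨p, hp, hp1, by dsimp only; omega⟩, ⟨q, hq, hq1, by dsimp only; omega⟩, ?_⟩
  rintro ⟨b, hb, h1, h2, hb3, hb4⟩
  dsimp only at hb3 hb4
  have hby : b.2 = y := by
    by_contra hne
    exact hB ⟨b, hb, h1, h2, hb3, by dsimp only; omega⟩
  have hbx : b.1 = x := by
    by_contra hne
    have := h4 b hb (by omega)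
    omega
  exact hxy (by rwa [← hbx, ← hby])

theorem mem_of_lower_corner (hS : IsPermSet n S) {x y : ℤ}
    (h₁ : Region S (x - 1, y)) (h₂ : ¬ Region S (x - 1, y - 1)) (h₃ : ¬ Region S (x, y)) :
    (x, y) ∈ S :=
  mem_of_upper_corner (S := transpose S) hS.transpose (region_transpose.2 h₁)
    (mt region_transpose.1 h₂) (mt region_transpose.1 h₃)

/-- The missing cell inherits `Under` and `Over` from its neighbours, so it is `Beyond` some point;
as neither neighbour is, that point is `(x, y)`. -/
theorem mem_of_reflex_corner {x y : ℤ}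
    (h₁ : Region S (x - 1, y)) (h₂ : Region S (x, y - 1)) (h₃ : ¬ Region S (x, y)) :
    (x, y) ∈ S := by
  obtain ⟨⟨p, hp, hp1, hp2⟩, -, hB₁⟩ := h₁
  obtain ⟨-, ⟨q, hq, hq1, hq2⟩, hB₂⟩ := h₂
  dsimp only at hp1 hp2 hq1 hq2
  by_contra hxy
  refine h₃ ⟨⟨p, hp, by dsimp only; omega, hp2⟩, ⟨q, hq, hq1, by dsimp only; omega⟩, ?_⟩
  rintro ⟨b, hb, h1, h2, hb3, hb4⟩
  dsimp only at hb3 hb4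
  have hbx : b.1 = x := by
    by_contra hne
    exact hB₁ ⟨b, hb, h1, h2, by dsimp only; omega, hb4⟩
  have hby : b.2 = y := by
    by_contra hne
    exact hB₂ ⟨b, hb, h1, h2, hb3, by dsimp only; omega⟩
  exact hxy (by rwa [← hbx, ← hby])

/-- An even vertex is a north-west corner, a south-east corner or a notch, and the notch opening to
the south-west is excluded by `region_of_diagonal`. Conversely, which of the NW and SE quadrants of
a point are occupied decides which pattern occurs. -/
theorem evenVertices_of_region (hS : IsPermSet n S) (hI : IsIndec n S) (hT : ThreeFaced S)
    (hn : 2 ≤ n) {P : Finset (ℤ × ℤ)} (hP : ∀ c, c ∈ P ↔ Region S c) : evenVertices P = S := by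
  ext ⟨x, y⟩
  simp only [mem_evenVertices, hP]
  constructor
  · have h1 := mem_of_upper_corner hS (x := x) (y := y)
    have h2 := mem_of_lower_corner hS (x := x) (y := y)
    have h3 := mem_of_reflex_corner (S := S) (x := x) (y := y)
    have h4 := region_of_diagonal (S := S) (x := x) (y := y)
    tauto
  · intro h
    have h1 := region_south_of_occSE hS hT h
    have h2 := region_west_of_occNW hS hT h
    have h3 := occ_of_isIndec hS hI hn h
    have h4 := not_region_of_not_occNW hS h
    have h5 := not_region_of_not_occSE hS h
    have h6 : OccNW S (x, y) → OccSE S (x, y) → ¬ Region S (x, y) :=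
      fun hNW hSE hR => hR.2.2 ⟨_, h, hNW, hSE, le_rfl, le_rfl⟩
    tauto

theorem isPermutomino_of_region {n : ℕ} (hS : IsPermSet (n + 1 : ℕ) S)
    (hI : IsIndec (n + 1 : ℕ) S) (hT : ThreeFaced S) (hn : 1 ≤ n) {P : Finset (ℤ × ℤ)}
    (hP : ∀ c, c ∈ P ↔ Region S c) :
    IsPermutomino P ∧ IsConvex P ∧ IsDirected P ∧ size P = n + 1 := by
  have he := evenVertices_of_region hS hI hT (by omega) hP
  have hfst : P.image Prod.fst = Finset.Icc (1 : ℤ) n := by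
    ext x
    rw [Finset.mem_image, Finset.mem_Icc]
    constructor
    · rintro ⟨c, hc, rfl⟩
      have := ((hP _).1 hc).bound hS
      omega
    · rintro ⟨h1, h2⟩
      obtain ⟨y, hy⟩ := exists_region_col hS hI hT h1 (by omega)
      exact ⟨_, (hP _).2 hy, rfl⟩
  have hsnd : P.image Prod.snd = Finset.Icc (1 : ℤ) n := by
    ext x
    rw [Finset.mem_image, Finset.mem_Icc]
    constructor
    · rintro ⟨c, hc, rfl⟩
      have := ((hP _).1 hc).bound hS
      omega
    · rintro ⟨h1, h2⟩
      obtain ⟨y, hy⟩ := exists_region_row hS hI hT h1 (by omega)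
      exact ⟨_, (hP _).2 hy, rfl⟩
  have hne : P.Nonempty := by
    rw [← Finset.image_nonempty (f := Prod.fst), hfst]
    exact ⟨1, Finset.mem_Icc.2 ⟨le_rfl, by omega⟩⟩
  have hc := isConvex_of_region hP
  have hd := isDirected_of_region hS hI hne hP
  refine ⟨⟨hd.isPolyomino, hc.holeFree, n, hn, hfst, hsnd, ?_, ?_⟩, hc, hd, ?_⟩
  -- The odd vertices come from counting; the two diagonal patterns are excluded by
  -- `region_of_diagonal` and `Region.pred`.
  · refine (isPermSet_oddVertices (he ▸ hS) (fun x y h => ((hP _).1 h).bound hS) (fun x y => ?_)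
      fun x y => ?_).exists_represents
    · simp only [hP]
      exact fun h1 h2 => .inl (region_of_diagonal h1 h2)
    · simp only [hP]
      intro h1 h2
      have hb := h1.bound hS
      rcases h2.pred hS hI with h | h | h
      · rw [Prod.mk.injEq] at h
        omega
      · exact .inl h
      · exact .inr h
  · exact (he ▸ hS : IsPermSet _ (evenVertices P)).exists_represents
  · simp [size, hfst]

end Backward
/-! ### Lattice paths -/

/-- The path `p` with `m` steps has an east step from `(x, a)`. -/
def EastAt (m : ℕ) (p : ℕ → ℤ × ℤ) (x a : ℤ) : Prop :=
  ∃ i < m, p i = (x, a) ∧ p (i + 1) = (x + 1, a)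

section Paths

variable {m : ℕ} {p : ℕ → ℤ × ℤ}

theorem IsNEPath.diag (h : IsNEPath m p) {i : ℕ} (hi : i ≤ m) :
    (p i).1 + (p i).2 = (p 0).1 + (p 0).2 + i := by
  induction i with
  | zero => simp
  | succ i ih =>
    have := ih (by omega)
    rcases h i (by omega) with h | h <;> rw [h] <;> push_cast <;> omega

theorem IsNEPath.mono (h : IsNEPath m p) {i j : ℕ} (hij : i ≤ j) (hj : j ≤ m) :
    (p i).1 ≤ (p j).1 ∧ (p i).2 ≤ (p j).2 := by
  induction j, hij using Nat.le_induction with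
  | base => simp
  | succ j hij ih =>
    have := ih (by omega)
    rcases h j (by omega) with h | h <;> rw [h] <;> dsimp only <;> omega

theorem IsNEPath.exists_east (h : IsNEPath m p) {x : ℤ} (h₀ : (p 0).1 ≤ x) (h₁ : x < (p m).1) :
    ∃ a, EastAt m p x a := by
  have key : ∀ j ≤ m, x < (p j).1 → ∃ i < j, ∃ a, p i = (x, a) ∧ p (i + 1) = (x + 1, a) := by
    intro j hj hx
    induction j with
    | zero => omega
    | succ j ih =>
      by_cases hxj : x < (p j).1
      · obtain ⟨i, hi, h⟩ := ih (by omega) hxj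
        exact ⟨i, by omega, h⟩
      · rcases h j (by omega) with h | h
        · rw [h] at hx
          dsimp only at hx
          obtain rfl : x = (p j).1 := by omega
          exact ⟨j, by omega, (p j).2, rfl, h⟩
        · rw [h] at hx
          exact absurd hx hxj
  obtain ⟨i, hi, a, h⟩ := key m le_rfl h₁
  exact ⟨a, i, hi, h⟩

theorem IsNEPath.east_bound (h : IsNEPath m p) {x a : ℤ} (hx : EastAt m p x a) :
    (p 0).1 ≤ x ∧ (p 0).2 ≤ a ∧ x < (p m).1 := by
  obtain ⟨i, hi, h1, h2⟩ := hx
  have h3 := h.mono (Nat.zero_le i) hi.le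
  have h4 := h.mono (i := i + 1) (j := m) hi le_rfl
  rw [h1] at h3
  rw [h2] at h4
  dsimp only at *
  omega

theorem IsNEPath.east_mono (h : IsNEPath m p) {x a x' a' : ℤ} (h₁ : EastAt m p x a)
    (h₂ : EastAt m p x' a') (hx : x ≤ x') : a ≤ a' := by
  obtain ⟨i, hi, h1, h2⟩ := h₁
  obtain ⟨j, hj, h3, h4⟩ := h₂
  by_cases hij : i ≤ j
  · have := h.mono hij hj.le
    rw [h1, h3] at this
    exact this.2
  · have := h.mono (i := j + 1) (j := i) (by omega) hi.le
    rw [h4, h1] at this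
    dsimp only at this
    omega

end Paths

/-! ### Parallelogram sets of cells -/

section Parallelogram

variable {P : Finset (ℤ × ℤ)}

theorem IsParallelogram.isConvex (h : IsParallelogram P) : IsConvex P := by
  obtain ⟨m, u, l, hu, hl, -, -, -, hP⟩ := h
  constructor
  · refine fun x => ⟨fun y₁ h₁ y₂ h₂ y hy => ?_⟩
    obtain ⟨a, -, ha, -, hla, -⟩ := (hP _ _).1 h₁
    obtain ⟨-, b, -, hb, -, hub⟩ := (hP _ _).1 h₂
    exact (hP _ _).2 ⟨a, b, ha.trans hy.1, by linarith [hy.2], hla, hub⟩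
  · refine fun y => ⟨fun x₁ h₁ x₂ h₂ x hx => ?_⟩
    obtain ⟨a, b, ha, hb, hla, hub⟩ := (hP _ _).1 h₁
    obtain ⟨a', b', ha', hb', hla', hub'⟩ := (hP _ _).1 h₂
    obtain ⟨c, hc⟩ := hl.exists_east ((hl.east_bound hla).1.trans hx.1)
      (hx.2.trans_lt (hl.east_bound hla').2.2)
    obtain ⟨d, hd⟩ := hu.exists_east ((hu.east_bound hub).1.trans hx.1)
      (hx.2.trans_lt (hu.east_bound hub').2.2)
    exact (hP _ _).2 ⟨c, d, (hl.east_mono hc hla' hx.2).trans ha',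
      hb.trans (hu.east_mono hub hd hx.1), hc, hd⟩

/-- The upper path never descends, so there is no notch opening to the north-east. This separates
parallelogram polyominoes from the other directed convex ones. -/
theorem IsParallelogram.mem_of_reflex (h : IsParallelogram P) {x y : ℤ} (h₁ : (x - 1, y) ∈ P)
    (h₂ : (x, y - 1) ∈ P) : (x, y) ∈ P := by
  obtain ⟨m, u, l, hu, hl, -, -, -, hP⟩ := h
  obtain ⟨a, b, ha, hb, hla, hub⟩ := (hP _ _).1 h₁
  obtain ⟨a', b', ha', hb', hla', hub'⟩ := (hP _ _).1 h₂
  exact (hP _ _).2 ⟨a', b', by omega, hb.trans (hu.east_mono hub hub' (by omega)), hla', hub'⟩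

theorem IsParallelogram.isDirected (h : IsParallelogram P) (hne : P.Nonempty)
    (hpos : ∀ c ∈ P, 1 ≤ c.1 ∧ 1 ≤ c.2) : IsDirected P := by
  obtain ⟨m, u, l, hu, hl, h0, -, hmeet, hP⟩ := h
  refine isDirected_of_pred (r := u 0) hne hpos ?_
  rintro ⟨x, y⟩ hc
  obtain ⟨a, b, ha, hb, hla, hub⟩ := (hP _ _).1 hc
  have hlb := hl.east_bound hla
  have hubd := hu.east_bound hub
  rcases lt_or_eq_of_le ha with hay | rfl
  · exact .inr (.inr ((hP _ _).2 ⟨a, b, by omega, by omega, hla, hub⟩))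
  obtain ⟨i, hi, hi1, hi2⟩ := id hla
  obtain ⟨j, hj, hj1, hj2⟩ := id hub
  have di := hl.diag hi.le
  have dj := hu.diag hj.le
  rw [hi1, ← h0] at di
  rw [hj1] at dj
  rw [← h0] at hlb
  dsimp only at di dj
  rcases lt_or_eq_of_le hubd.1 with hx | hx
  · obtain ⟨a', ha'⟩ := hl.exists_east (x := x - 1) (by rw [← h0]; omega) (by omega)
    obtain ⟨b', hb'⟩ := hu.exists_east (x := x - 1) (by omega) (by omega)
    have haa := hl.east_mono ha' hla (by omega)
    by_cases hba : a + 1 ≤ b'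
    · exact .inr (.inl ((hP _ _).2 ⟨a', b', haa, hba, ha', hb'⟩))
    -- Here the upper path reaches abscissa `x` by time `i` and stays on it until time `j`. At time
    -- `i` both paths thus have equal abscissa and equal coordinate sum, so they meet.
    · obtain ⟨k, hk, hk1, hk2⟩ := hb'
      have dk := hu.diag (i := k + 1) hk
      rw [hk2] at dk
      push_cast at dk
      have h1 := (hu.mono (i := k + 1) (j := i) (by omega) hi.le).1
      have h2 := (hu.mono (i := i) (j := j) (by omega) hj.le).1
      rw [hk2] at h1
      rw [hj1] at h2
      have dui := hu.diag hi.le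
      dsimp only at h1 h2
      have hui : u i = l i := by
        rw [hi1]
        exact Prod.ext (by dsimp only; omega) (by dsimp only; omega)
      rcases hmeet i hi.le i hi.le hui with h | h
      · obtain ⟨rfl, -⟩ := h
        rw [hui, hi1] at hx
        dsimp only at hx
        omega
      · omega
  · left
    refine Prod.ext hx.symm ?_
    dsimp only
    -- In the first column, a lowest cell above the origin would make both paths start with a north
    -- step and meet at time 1.
    by_contra hne
    have h1 := (hl.mono (i := 1) (j := i) (by omega) hi.le).1
    have h2 := (hu.mono (i := 1) (j := j) (by omega) hj.le).1
    have h3 := (hl.mono (i := 0) (j := 1) (by omega) (by omega)).1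
    have h4 := (hu.mono (i := 0) (j := 1) (by omega) (by omega)).1
    have h5 := hl.diag (i := 1) (by omega)
    have h6 := hu.diag (i := 1) (by omega)
    rw [hi1] at h1
    rw [hj1] at h2
    rw [← h0] at h3 h5
    dsimp only at h1 h2
    have := hmeet 1 (by omega) 1 (by omega) (Prod.ext (by omega) (by omega))
    omega

end Parallelogram

/-! ### The boundary paths of the region of a two-faced permutation -/

open Classical in
/-- The path that goes north as long as it is below a point of `S` weakly to the left. -/
noncomputable def upperPath (S : Set (ℤ × ℤ)) : ℕ → ℤ × ℤ
  | 0 => (1, 1)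
  | k + 1 => if Under S (upperPath S k) then ((upperPath S k).1, (upperPath S k).2 + 1)
      else ((upperPath S k).1 + 1, (upperPath S k).2)

/-- The reflection of the upper path of the reflection of `S`. -/
noncomputable def lowerPath (S : Set (ℤ × ℤ)) (k : ℕ) : ℤ × ℤ := (upperPath (transpose S) k).swap

theorem upperPath_succ_of_under {S : Set (ℤ × ℤ)} {k : ℕ} (h : Under S (upperPath S k)) :
    upperPath S (k + 1) = ((upperPath S k).1, (upperPath S k).2 + 1) := by
  rw [upperPath, if_pos h]

theorem upperPath_succ_of_not_under {S : Set (ℤ × ℤ)} {k : ℕ} (h : ¬ Under S (upperPath S k)) :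
    upperPath S (k + 1) = ((upperPath S k).1 + 1, (upperPath S k).2) := by
  rw [upperPath, if_neg h]

theorem isNEPath_upperPath (S : Set (ℤ × ℤ)) (m : ℕ) : IsNEPath m (upperPath S) := fun i _ => by
  by_cases h : Under S (upperPath S i)
  · exact .inr (upperPath_succ_of_under h)
  · exact .inl (upperPath_succ_of_not_under h)

theorem isNEPath_lowerPath (S : Set (ℤ × ℤ)) (m : ℕ) : IsNEPath m (lowerPath S) := fun i hi => by
  unfold lowerPath
  rcases isNEPath_upperPath (transpose S) m i hi with h | h <;> rw [h]
  · exact .inr rfl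
  · exact .inl rfl

theorem upperPath_below {S : Set (ℤ × ℤ)} (k : ℕ) {n : ℤ} (hS : IsPermSet n S) :
    ∀ p ∈ S, p.1 < (upperPath S k).1 → p.2 ≤ (upperPath S k).2 := by
  induction k with
  | zero =>
    intro p hp h
    have := hS.bound p hp
    simp only [upperPath] at h
    omega
  | succ k ih =>
    intro p hp h
    by_cases hU : Under S (upperPath S k)
    · rw [upperPath_succ_of_under hU] at h ⊢
      have := ih p hp h
      dsimp only
      omega
    · rw [upperPath_succ_of_not_under hU] at h ⊢
      dsimp only at h ⊢
      by_contra! hlt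
      exact hU ⟨p, hp, by omega, hlt⟩

theorem upperPath_attained {S : Set (ℤ × ℤ)} (k : ℕ) (h : 1 < (upperPath S k).2) :
    ∃ p ∈ S, p.1 ≤ (upperPath S k).1 ∧ (upperPath S k).2 ≤ p.2 := by
  induction k with
  | zero => simp [upperPath] at h
  | succ k ih =>
    by_cases hU : Under S (upperPath S k)
    · obtain ⟨p, hp, h1, h2⟩ := hU
      rw [upperPath_succ_of_under ⟨p, hp, h1, h2⟩]
      exact ⟨p, hp, h1, h2⟩
    · rw [upperPath_succ_of_not_under hU] at h ⊢
      obtain ⟨p, hp, h1, h2⟩ := ih h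
      exact ⟨p, hp, by dsimp only; omega, h2⟩

/-- The path never rises above height `n`. At abscissa `n` it still passes under the point of height
`n`, so it cannot go east before reaching `(n, n)`. -/
theorem upperPath_le {S : Set (ℤ × ℤ)} {n : ℕ} (hS : IsPermSet n S) (hn : 1 ≤ n) {k : ℕ}
    (hk : k ≤ 2 * (n - 1)) : (upperPath S k).1 ≤ n ∧ (upperPath S k).2 ≤ n := by
  have h2 : ∀ k, (upperPath S k).2 ≤ n := fun k => by
    by_contra! h
    obtain ⟨p, hp, -, h2⟩ := upperPath_attained (S := S) k (by omega)
    have := hS.bound p hp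
    omega
  refine ⟨?_, h2 k⟩
  induction k with
  | zero => simp only [upperPath]; omega
  | succ k ih =>
    have hk' := ih (by omega)
    by_cases hU : Under S (upperPath S k)
    · rwa [upperPath_succ_of_under hU]
    · rw [upperPath_succ_of_not_under hU]
      dsimp only
      by_contra! hlt
      have hd := (isNEPath_upperPath S k).diag le_rfl
      obtain ⟨x, hx⟩ := hS.surj_snd n (by omega) le_rfl
      have hb := hS.bound _ hx
      dsimp only at hb
      have := h2 k
      have hlt2 : (upperPath S k).2 < n := by
        have h0 : upperPath S 0 = (1, 1) := rfl
        rw [h0] at hd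
        dsimp only at hd
        omega
      exact hU ⟨_, hx, by dsimp only; omega, hlt2⟩

theorem upperPath_end {S : Set (ℤ × ℤ)} {n : ℕ} (hS : IsPermSet n S) (hn : 1 ≤ n) :
    upperPath S (2 * (n - 1)) = ((n : ℤ), (n : ℤ)) := by
  have h1 := upperPath_le hS hn le_rfl
  have hd := (isNEPath_upperPath S (2 * (n - 1))).diag le_rfl
  have h0 : upperPath S 0 = (1, 1) := rfl
  rw [h0] at hd
  dsimp only at hd
  exact Prod.ext (by dsimp only; omega) (by dsimp only; omega)

theorem not_under_of_eastAt {S : Set (ℤ × ℤ)} {m : ℕ} {x b : ℤ}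
    (h : EastAt m (upperPath S) x b) : ¬ Under S (x, b) := by
  obtain ⟨i, -, h1, h2⟩ := h
  intro hU
  rw [← h1] at hU
  rw [upperPath_succ_of_under hU, h1, Prod.mk.injEq] at h2
  omega

theorem over_of_eastAt {S : Set (ℤ × ℤ)} {m : ℕ} {x a : ℤ}
    (h : EastAt m (lowerPath S) x a) : Over S (x, a) := by
  obtain ⟨i, -, h1, h2⟩ := h
  have h1' : upperPath (transpose S) i = (a, x) := by
    rw [← Prod.swap_swap (upperPath (transpose S) i)]
    exact congrArg Prod.swap h1
  by_contra hO
  rw [← under_transpose, ← h1'] at hO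
  rw [lowerPath, upperPath_succ_of_not_under hO, h1', Prod.swap_prod_mk, Prod.mk.injEq] at h2
  omega

theorem upperPath_lowerPath_meet {S : Set (ℤ × ℤ)} {n : ℕ} (hS : IsPermSet n S)
    (hI : IsIndec n S) (hn : 1 ≤ n) {i j : ℕ} (hi : i ≤ 2 * (n - 1))
    (h : upperPath S i = lowerPath S j) :
    (i = 0 ∧ j = 0) ∨ (i = 2 * (n - 1) ∧ j = 2 * (n - 1)) := by
  have hu1 := upperPath_below i hS
  have hl1 : ∀ p ∈ S, p.2 < (lowerPath S j).2 → p.1 ≤ (lowerPath S j).1 := fun p hp =>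
    upperPath_below j hS.transpose p.swap hp
  have hdi := (isNEPath_upperPath S i).diag le_rfl
  have hdj := (isNEPath_lowerPath S j).diag le_rfl
  have hmi := (isNEPath_upperPath S i).mono (Nat.zero_le i) le_rfl
  have hle := upperPath_le hS hn hi
  rw [← h] at hl1 hdj
  have h0 : upperPath S 0 = (1, 1) := rfl
  have h0' : lowerPath S 0 = (1, 1) := rfl
  rw [h0] at hdi hmi
  rw [h0'] at hdj
  generalize upperPath S i = c at *
  obtain ⟨x, y⟩ := c
  dsimp only at *
  have hxy : x ≤ y := by
    by_contra! hlt
    obtain ⟨s, hs, hs1, hs2⟩ := hI.above (x - 1) (by omega) (by omega)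
    have := hu1 s hs (by omega)
    omega
  have hyx : y ≤ x := by
    by_contra! hlt
    obtain ⟨s, hs, hs1, hs2⟩ := hI.below (y - 1) (by omega) (by omega)
    have := hl1 s hs (by omega)
    omega
  obtain rfl : x = y := le_antisymm hxy hyx
  -- At the two ends of the diagonal the coordinate sums determine both times.
  by_cases hx1 : x = 1
  · omega
  by_cases hxn : x = n
  · omega
  -- Strictly inside, indecomposability gives a point below and a point above the diagonal, and the
  -- position of the paths forces both to abscissa `x`.
  obtain ⟨q, hq, hq1, hq2⟩ := hI.below (x - 1) (by omega) (by omega)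
  obtain ⟨s, hs, hs1, hs2⟩ := hI.above x (by omega) (by omega)
  have h1 := hl1 q hq (by omega)
  have h2 := hu1 s hs
  have h3 := congrArg Prod.snd (hS.inj_fst s hs q hq (by omega))
  omega

/-- For a two-faced set `Beyond` is void, and the region is what lies between the two staircases. -/
theorem isParallelogram_of_region {S : Set (ℤ × ℤ)} {n : ℕ} (hS : IsPermSet n S)
    (hI : IsIndec n S) (hT : TwoFaced S) (hn : 1 ≤ n) {P : Finset (ℤ × ℤ)}
    (hP : ∀ c, c ∈ P ↔ Region S c) : IsParallelogram P := by
  have hu := isNEPath_upperPath S (2 * (n - 1))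
  have hl := isNEPath_lowerPath S (2 * (n - 1))
  have hum := upperPath_end hS hn
  have hlm : lowerPath S (2 * (n - 1)) = ((n : ℤ), (n : ℤ)) := by
    rw [lowerPath, upperPath_end hS.transpose hn, Prod.swap_prod_mk]
  refine ⟨2 * (n - 1), upperPath S, lowerPath S, hu, hl, rfl, hum.trans hlm.symm,
    fun i hi j _ h => upperPath_lowerPath_meet hS hI hn hi h, fun x y => ?_⟩
  rw [hP]
  constructor
  · intro h
    have hb := h.bound hS
    obtain ⟨⟨p, hp, hp1, hp2⟩, ⟨q, hq, hq1, hq2⟩, -⟩ := h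
    obtain ⟨b, hub⟩ := hu.exists_east (x := x) hb.1 (by rw [hum]; exact hb.2.1)
    obtain ⟨a, hla⟩ := hl.exists_east (x := x) hb.1 (by rw [hlm]; exact hb.2.1)
    refine ⟨a, b, ?_, ?_, hla, hub⟩
    · obtain ⟨i, -, hi, -⟩ := hla
      by_contra! hlt
      have := upperPath_below i hS.transpose q.swap hq
      have h1 : upperPath (transpose S) i = (a, x) := by
        rw [← Prod.swap_swap (upperPath (transpose S) i)]
        exact congrArg Prod.swap hi
      rw [h1] at this
      dsimp only [Prod.fst_swap, Prod.snd_swap] at *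
      omega
    · by_contra! hlt
      exact not_under_of_eastAt hub ⟨p, hp, hp1, by dsimp only at *; omega⟩
  · rintro ⟨a, b, ha, hb, hla, hub⟩
    obtain ⟨q, hq, hq1, hq2⟩ := over_of_eastAt hla
    have h1 := (hl.east_bound hla).2.1
    have h0 : lowerPath S 0 = (1, 1) := rfl
    rw [h0] at h1
    dsimp only at h1 hq1 hq2
    refine ⟨?_, ⟨q, hq, hq1, by dsimp only; omega⟩, fun ⟨p, hp, hNW, hSE, _⟩ => hT p hp hNW hSE⟩
    obtain ⟨i, -, hi, -⟩ := hub
    obtain ⟨p, hp, hp1, hp2⟩ := upperPath_attained (S := S) i (by rw [hi]; dsimp only; omega)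
    rw [hi] at hp1 hp2
    exact ⟨p, hp, hp1, by dsimp only at *; omega⟩

/-- A point with both quadrants occupied would be a notch, which `mem_of_reflex` fills and `Beyond`
forbids. -/
theorem twoFaced_of_isParallelogram {S : Set (ℤ × ℤ)} {n : ℤ} (hS : IsPermSet n S)
    (hT : ThreeFaced S) {P : Finset (ℤ × ℤ)} (hP : ∀ c, c ∈ P ↔ Region S c)
    (h : IsParallelogram P) : TwoFaced S := by
  rintro ⟨x, y⟩ hp hNW hSE
  have hm := h.mem_of_reflex ((hP _).2 (region_west_of_occNW hS hT hp hNW))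
    ((hP _).2 (region_south_of_occSE hS hT hp hSE))
  exact ((hP _).1 hm).2.2 ⟨_, hp, hNW, hSE, le_rfl, le_rfl⟩

/-! ### Permutations of arbitrary size -/

/-- Permutations of all sizes. -/
abbrev SizedPerm := Σ n : ℕ, Equiv.Perm (Fin n)

namespace SizedPerm

/-- The entry at position `i`, counted from `0`. -/
def entry (s : SizedPerm) (i : ℕ) : ℕ := if h : i < s.1 then s.2 ⟨i, h⟩ else 0

theorem entry_coe (s : SizedPerm) (i : Fin s.1) : s.entry i = s.2 i := by
  simp [entry]

theorem entry_mk {n : ℕ} (π : Equiv.Perm (Fin n)) (i : Fin n) : entry ⟨n, π⟩ i = π i :=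
  entry_coe ⟨n, π⟩ i

theorem entry_lt (s : SizedPerm) {i : ℕ} (h : i < s.1) : s.entry i < s.1 := by
  rw [entry, dif_pos h]
  exact (s.2 _).2

theorem ext_entry {s t : SizedPerm} (h : s.1 = t.1)
    (he : ∀ i < s.1, s.entry i = t.entry i) : s = t := by
  obtain ⟨n, π⟩ := s
  obtain ⟨m, σ⟩ := t
  obtain rfl : n = m := h
  congr 1
  ext i
  have := he i i.2
  rwa [entry_mk, entry_mk] at this

/-- The direct difference. -/
def diff (s t : SizedPerm) : SizedPerm := ⟨s.1 + t.1, directDiff s.2 t.2⟩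

theorem diff_fst (s t : SizedPerm) : (diff s t).1 = s.1 + t.1 := rfl

theorem entry_diff_left (s t : SizedPerm) {i : ℕ} (h : i < s.1) :
    (diff s t).entry i = s.entry i + t.1 := by
  have := entry_coe (diff s t) (Fin.castAdd t.1 ⟨i, h⟩)
  rw [Fin.val_castAdd] at this
  rw [this, entry, dif_pos h]
  exact directDiff_castAdd s.2 t.2 ⟨i, h⟩

theorem entry_diff_right (s t : SizedPerm) {i : ℕ} (h : i < t.1) :
    (diff s t).entry (s.1 + i) = t.entry i := by
  have := entry_coe (diff s t) (Fin.natAdd s.1 ⟨i, h⟩)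
  rw [Fin.val_natAdd] at this
  rw [this, entry, dif_pos h]
  exact directDiff_natAdd s.2 t.2 ⟨i, h⟩

/-- The inverse permutation. -/
def inv (s : SizedPerm) : SizedPerm := ⟨s.1, s.2.symm⟩

theorem inv_inv (s : SizedPerm) : s.inv.inv = s := rfl

theorem entry_inv_entry (s : SizedPerm) {i : ℕ} (h : i < s.1) : s.inv.entry (s.entry i) = i := by
  have h1 := entry_coe s ⟨i, h⟩
  have h2 := entry_coe s.inv (s.2 ⟨i, h⟩)
  rw [h1, h2]
  exact congrArg Fin.val (s.2.symm_apply_apply ⟨i, h⟩)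

/-! ### Cutting a permutation -/

/-- By counting, the first `m` entries take all values from `m'` on, so the remaining entries are
below `m'`. -/
theorem exists_directDiff {m m' : ℕ} (π : Equiv.Perm (Fin (m + m')))
    (h : ∀ i : Fin m, m' ≤ (π (Fin.castAdd m' i) : ℕ)) :
    ∃ (θ : Equiv.Perm (Fin m)) (θ' : Equiv.Perm (Fin m')), π = directDiff θ θ' := by
  let f : Fin m → Fin m := fun i => ⟨π (Fin.castAdd m' i) - m', by
    have := h i
    have := (π (Fin.castAdd m' i)).2
    omega⟩
  have hf : Function.Injective f := fun i j hij => by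
    have h1 := h i
    have h2 := h j
    have h3 := congrArg Fin.val hij
    dsimp only [f] at h3
    exact Fin.castAdd_injective m m' (π.injective (Fin.ext (by omega)))
  have hfs := Finite.surjective_of_injective hf
  have hlt : ∀ j : Fin m', (π (Fin.natAdd m j) : ℕ) < m' := fun j => by
    by_contra! hge
    have hlt := (π (Fin.natAdd m j)).2
    obtain ⟨i, hi⟩ := hfs ⟨π (Fin.natAdd m j) - m', by omega⟩
    have h1 := h i
    have h3 := congrArg Fin.val hi
    dsimp only [f] at h3
    have h4 := congrArg Fin.val (π.injective (a₁ := Fin.castAdd m' i) (a₂ := Fin.natAdd m j)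
      (Fin.ext (by omega)))
    rw [Fin.val_castAdd, Fin.val_natAdd] at h4
    omega
  let g : Fin m' → Fin m' := fun j => ⟨π (Fin.natAdd m j), hlt j⟩
  have hg : Function.Injective g := fun i j hij => by
    have h3 := congrArg Fin.val hij
    exact Fin.natAdd_injective m' m (π.injective (Fin.ext h3))
  refine ⟨Equiv.ofBijective f (Finite.injective_iff_bijective.1 hf),
    Equiv.ofBijective g (Finite.injective_iff_bijective.1 hg), Equiv.ext fun i => Fin.ext ?_⟩
  induction i using Fin.addCases with
  | left i =>
    rw [directDiff_castAdd]
    have := h i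
    simp only [Equiv.ofBijective_apply, f]
    omega
  | right j =>
    rw [directDiff_natAdd]
    simp only [Equiv.ofBijective_apply, g]

/-- Indecomposability. -/
def Indec (s : SizedPerm) : Prop := Indecomposable s.2

theorem indec_iff {s : SizedPerm} : s.Indec ↔
    0 < s.1 ∧ ∀ m, 0 < m → m < s.1 → ∃ i < m, s.entry i + m < s.1 := by
  obtain ⟨n, π⟩ := s
  refine and_congr_right fun _ => ⟨fun h m hm hmn => ?_, fun h => ?_⟩
  · by_contra! hcon
    obtain ⟨m', rfl⟩ := Nat.exists_eq_add_of_le hmn.le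
    dsimp only at hmn
    obtain ⟨θ, θ', e⟩ := exists_directDiff π fun i => by
      have h1 := hcon i i.2
      have h2 := entry_mk π (Fin.castAdd m' i)
      rw [Fin.val_castAdd] at h2
      rw [h2] at h1
      dsimp only at h1
      omega
    exact h ⟨m, m', rfl, θ, θ', hm, by omega, by rw [e]; rfl⟩
  · rintro ⟨m, m', h', θ, θ', hm, hm', e⟩
    dsimp only at h'
    subst h'
    obtain rfl : π = directDiff θ θ' := e
    obtain ⟨i, hi, h2⟩ := h m hm (by dsimp only; omega)
    have := entry_diff_left ⟨m, θ⟩ ⟨m', θ'⟩ hi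
    rw [diff] at this
    dsimp only at this h2
    omega

theorem Indec.pos {s : SizedPerm} (h : s.Indec) : 0 < s.1 := (indec_iff.1 h).1

/-- If `s` were shorter than `s'`, its end would cut `s'`. -/
theorem Indec.fst_le {s t s' t' : SizedPerm} (hs' : s'.Indec) (hs : 0 < s.1)
    (h : diff s t = diff s' t') : s'.1 ≤ s.1 := by
  by_contra! hlt
  obtain ⟨i, hi, h1⟩ := (indec_iff.1 hs').2 s.1 hs hlt
  have h2 : s.1 + t.1 = s'.1 + t'.1 := congrArg Sigma.fst h
  have h3 := entry_diff_left s t hi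
  have h4 := entry_diff_left s' t' (hi.trans hlt)
  rw [h] at h3
  omega

/-- The first indecomposable component is unique. -/
theorem diff_injective {s t s' t' : SizedPerm} (hs : s.Indec) (hs' : s'.Indec)
    (h : diff s t = diff s' t') : s = s' ∧ t = t' := by
  have h1 : s.1 = s'.1 := le_antisymm (hs.fst_le hs'.pos h.symm) (hs'.fst_le hs.pos h)
  have h2 : s.1 + t.1 = s'.1 + t'.1 := congrArg Sigma.fst h
  refine ⟨ext_entry h1 fun i hi => ?_, ext_entry (by omega) fun i hi => ?_⟩
  · have h3 := entry_diff_left s t hi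
    have h4 := entry_diff_left s' t' (h1 ▸ hi)
    rw [h] at h3
    omega
  · have h3 := entry_diff_right s t hi
    have h4 := entry_diff_right s' t' (i := i) (by omega)
    rw [h, h1] at h3
    omega

theorem not_indec_diff {s t : SizedPerm} (hs : 0 < s.1) (ht : 0 < t.1) : ¬ (diff s t).Indec := by
  intro h
  obtain ⟨i, hi, h1⟩ := (indec_iff.1 h).2 s.1 hs (by rw [diff_fst]; omega)
  rw [entry_diff_left s t hi, diff_fst] at h1
  omega

theorem Indec.inv {s : SizedPerm} (h : s.Indec) : s.inv.Indec := by
  rw [indec_iff] at h ⊢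
  refine ⟨h.1, fun m hm (hms : m < s.1) => ?_⟩
  -- Inversion exchanges positions and values, so the cut at `m` becomes the cut at `s.1 - m`.
  obtain ⟨i, hi, h1⟩ := h.2 (s.1 - m) (by omega) (by omega)
  refine ⟨s.entry i, by omega, ?_⟩
  rw [entry_inv_entry s (by omega)]
  change i + m < s.1
  omega

/-! ### Empty quadrants -/

/-- Some entry to the left of position `b` is smaller than the entry at `b`. -/
def SW (s : SizedPerm) (b : ℕ) : Prop := ∃ a < b, s.entry a < s.entry b

/-- Some entry to the left of position `b` is larger than the entry at `b`. -/
def NW (s : SizedPerm) (b : ℕ) : Prop := ∃ a < b, s.entry b < s.entry a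

/-- Some entry to the right of position `b` is smaller than the entry at `b`. -/
def SE (s : SizedPerm) (b : ℕ) : Prop := ∃ c, b < c ∧ c < s.1 ∧ s.entry c < s.entry b

/-- Some entry to the right of position `b` is larger than the entry at `b`. -/
def NE (s : SizedPerm) (b : ℕ) : Prop := ∃ c, b < c ∧ c < s.1 ∧ s.entry b < s.entry c

/-- Every entry has an empty quadrant. -/
def FourFaces (s : SizedPerm) : Prop := ∀ b < s.1, s.SW b → s.SE b → s.NW b → ¬ s.NE b

/-- Every entry has an empty south-west, north-west or north-east quadrant. -/
def FirstFaces (s : SizedPerm) : Prop := ∀ b < s.1, s.SW b → s.NW b → ¬ s.NE b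

/-- Every entry has an empty south-west, south-east or north-east quadrant. -/
def LastFaces (s : SizedPerm) : Prop := ∀ b < s.1, s.SW b → s.SE b → ¬ s.NE b

/-- Every entry has an empty south-west or north-east quadrant. -/
def MidFaces (s : SizedPerm) : Prop := ∀ b < s.1, s.SW b → ¬ s.NE b

theorem MidFaces.lastFaces {s : SizedPerm} (h : s.MidFaces) : s.LastFaces :=
  fun b hb h1 _ => h b hb h1

section Diff

variable {s t : SizedPerm} {b : ℕ}

theorem sw_diff_left (h : b < s.1) : (diff s t).SW b ↔ s.SW b := by
  refine exists_congr fun a => and_congr_right fun ha => ?_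
  rw [entry_diff_left s t h, entry_diff_left s t (ha.trans h)]
  omega

theorem nw_diff_left (h : b < s.1) : (diff s t).NW b ↔ s.NW b := by
  refine exists_congr fun a => and_congr_right fun ha => ?_
  rw [entry_diff_left s t h, entry_diff_left s t (ha.trans h)]
  omega

theorem se_diff_left (ht : 0 < t.1) (h : b < s.1) : (diff s t).SE b := by
  refine ⟨s.1 + 0, h, by rw [diff_fst]; omega, ?_⟩
  rw [entry_diff_left s t h, entry_diff_right s t ht]
  have := t.entry_lt ht
  omega

theorem ne_diff_left (h : b < s.1) : (diff s t).NE b ↔ s.NE b := by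
  constructor
  · rintro ⟨c, h1, h2, h3⟩
    rw [diff_fst] at h2
    rw [entry_diff_left s t h] at h3
    by_cases hc : c < s.1
    · rw [entry_diff_left s t hc] at h3
      exact ⟨c, h1, hc, by omega⟩
    · obtain ⟨d, rfl⟩ := Nat.exists_eq_add_of_le (not_lt.1 hc)
      rw [entry_diff_right s t (by omega)] at h3
      have := t.entry_lt (i := d) (by omega)
      omega
  · rintro ⟨c, h1, h2, h3⟩
    refine ⟨c, h1, by rw [diff_fst]; omega, ?_⟩
    rw [entry_diff_left s t h, entry_diff_left s t h2]
    omega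

theorem nw_diff_right (hs : 0 < s.1) (h : b < t.1) : (diff s t).NW (s.1 + b) := by
  refine ⟨0, by omega, ?_⟩
  rw [entry_diff_left s t hs, entry_diff_right s t h]
  have := t.entry_lt h
  omega

theorem sw_diff_right (h : b < t.1) : (diff s t).SW (s.1 + b) ↔ t.SW b := by
  constructor
  · rintro ⟨a, h1, h2⟩
    rw [entry_diff_right s t h] at h2
    by_cases ha : a < s.1
    · rw [entry_diff_left s t ha] at h2
      have := t.entry_lt h
      omega
    · obtain ⟨d, rfl⟩ := Nat.exists_eq_add_of_le (not_lt.1 ha)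
      rw [entry_diff_right s t (by omega)] at h2
      exact ⟨d, by omega, h2⟩
  · rintro ⟨a, h1, h2⟩
    refine ⟨s.1 + a, by omega, ?_⟩
    rwa [entry_diff_right s t h, entry_diff_right s t (by omega)]

theorem se_diff_right (h : b < t.1) : (diff s t).SE (s.1 + b) ↔ t.SE b := by
  constructor
  · rintro ⟨c, h1, h2, h3⟩
    obtain ⟨d, rfl⟩ := Nat.exists_eq_add_of_le (show s.1 ≤ c by omega)
    rw [diff_fst] at h2
    rw [entry_diff_right s t h, entry_diff_right s t (by omega)] at h3
    exact ⟨d, by omega, by omega, h3⟩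
  · rintro ⟨c, h1, h2, h3⟩
    refine ⟨s.1 + c, by omega, by rw [diff_fst]; omega, ?_⟩
    rwa [entry_diff_right s t h, entry_diff_right s t h2]

theorem ne_diff_right (h : b < t.1) : (diff s t).NE (s.1 + b) ↔ t.NE b := by
  constructor
  · rintro ⟨c, h1, h2, h3⟩
    obtain ⟨d, rfl⟩ := Nat.exists_eq_add_of_le (show s.1 ≤ c by omega)
    rw [diff_fst] at h2
    rw [entry_diff_right s t h, entry_diff_right s t (by omega)] at h3
    exact ⟨d, by omega, by omega, h3⟩
  · rintro ⟨c, h1, h2, h3⟩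
    refine ⟨s.1 + c, by omega, by rw [diff_fst]; omega, ?_⟩
    rwa [entry_diff_right s t h, entry_diff_right s t h2]

theorem forall_lt_diff {p : ℕ → Prop} :
    (∀ b < (diff s t).1, p b) ↔ (∀ b < s.1, p b) ∧ ∀ b < t.1, p (s.1 + b) := by
  rw [diff_fst]
  refine ⟨fun h => ⟨fun b hb => h b (by omega), fun b hb => h _ (by omega)⟩,
    fun h b hb => ?_⟩
  by_cases hbs : b < s.1
  · exact h.1 b hbs
  · obtain ⟨d, rfl⟩ := Nat.exists_eq_add_of_le (not_lt.1 hbs)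
    exact h.2 d (by omega)

/-- All of `t` lies south-east of each entry of `s`, and all of `s` north-west of each entry of `t`.
These quadrants are never empty and drop out of the condition. -/
theorem fourFaces_diff (hs : 0 < s.1) (ht : 0 < t.1) :
    (diff s t).FourFaces ↔ s.FirstFaces ∧ t.LastFaces := by
  rw [FourFaces, forall_lt_diff]
  refine and_congr (forall₂_congr fun b hb => ?_) (forall₂_congr fun b hb => ?_)
  · simp only [sw_diff_left hb, nw_diff_left hb, ne_diff_left hb, se_diff_left ht hb, true_imp_iff]
  · simp only [sw_diff_right hb, se_diff_right hb, ne_diff_right hb, nw_diff_right hs hb,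
      true_imp_iff]

theorem lastFaces_diff (ht : 0 < t.1) :
    (diff s t).LastFaces ↔ s.MidFaces ∧ t.LastFaces := by
  rw [LastFaces, forall_lt_diff]
  refine and_congr (forall₂_congr fun b hb => ?_) (forall₂_congr fun b hb => ?_)
  · simp only [sw_diff_left hb, ne_diff_left hb, se_diff_left ht hb, true_imp_iff]
  · simp only [sw_diff_right hb, se_diff_right hb, ne_diff_right hb]

end Diff

theorem sw_inv {s : SizedPerm} {b : ℕ} (hb : b < s.1) (h : s.inv.SW (s.entry b)) : s.SW b := by
  obtain ⟨v, h1, h2⟩ := h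
  have hv : v < s.inv.1 := h1.trans (s.entry_lt hb)
  have e : s.entry (s.inv.entry v) = v := entry_inv_entry s.inv hv
  rw [entry_inv_entry s hb] at h2
  exact ⟨_, h2, by rwa [e]⟩

theorem se_inv {s : SizedPerm} {b : ℕ} (hb : b < s.1) (h : s.inv.SE (s.entry b)) : s.NW b := by
  obtain ⟨v, h1, hv, h2⟩ := h
  have e : s.entry (s.inv.entry v) = v := entry_inv_entry s.inv hv
  rw [entry_inv_entry s hb] at h2
  exact ⟨_, h2, by rwa [e]⟩

theorem nw_inv {s : SizedPerm} {b : ℕ} (hb : b < s.1) (h : s.inv.NW (s.entry b)) : s.SE b := by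
  obtain ⟨v, h1, h2⟩ := h
  have hv : v < s.inv.1 := h1.trans (s.entry_lt hb)
  have e : s.entry (s.inv.entry v) = v := entry_inv_entry s.inv hv
  rw [entry_inv_entry s hb] at h2
  exact ⟨_, h2, s.inv.entry_lt hv, by rwa [e]⟩

theorem ne_inv {s : SizedPerm} {b : ℕ} (hb : b < s.1) (h : s.inv.NE (s.entry b)) : s.NE b := by
  obtain ⟨v, h1, hv, h2⟩ := h
  have e : s.entry (s.inv.entry v) = v := entry_inv_entry s.inv hv
  rw [entry_inv_entry s hb] at h2
  exact ⟨_, h2, s.inv.entry_lt hv, by rwa [e]⟩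

theorem forall_inv {s : SizedPerm} {p : ℕ → Prop} (h : ∀ b < s.1, p (s.entry b)) :
    ∀ b < s.inv.1, p b := fun b hb => by
  have e : s.entry (s.inv.entry b) = b := entry_inv_entry s.inv hb
  rw [← e]
  exact h _ (s.inv.entry_lt hb)

theorem FirstFaces.inv {s : SizedPerm} (h : s.FirstFaces) : s.inv.LastFaces :=
  forall_inv fun b hb h1 h2 h3 => h b hb (sw_inv hb h1) (se_inv hb h2) (ne_inv hb h3)

theorem LastFaces.inv {s : SizedPerm} (h : s.LastFaces) : s.inv.FirstFaces :=
  forall_inv fun b hb h1 h2 h3 => h b hb (sw_inv hb h1) (nw_inv hb h2) (ne_inv hb h3)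

/-! ### Square permutations -/

section Fin

variable {n : ℕ} {π : Equiv.Perm (Fin n)} {b : Fin n}

theorem sw_iff : SW ⟨n, π⟩ b ↔ ∃ a < b, π a < π b := by
  constructor
  · rintro ⟨a, h1, h2⟩
    refine ⟨⟨a, h1.trans b.2⟩, h1, ?_⟩
    rwa [Fin.lt_def, ← entry_mk π ⟨a, _⟩, ← entry_mk π b]
  · rintro ⟨a, h1, h2⟩
    exact ⟨a, h1, by rwa [entry_mk, entry_mk]⟩

theorem nw_iff : NW ⟨n, π⟩ b ↔ ∃ a < b, π b < π a := by
  constructor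
  · rintro ⟨a, h1, h2⟩
    refine ⟨⟨a, h1.trans b.2⟩, h1, ?_⟩
    rwa [Fin.lt_def, ← entry_mk π ⟨a, _⟩, ← entry_mk π b]
  · rintro ⟨a, h1, h2⟩
    exact ⟨a, h1, by rwa [entry_mk, entry_mk]⟩

theorem se_iff : SE ⟨n, π⟩ b ↔ ∃ c > b, π c < π b := by
  constructor
  · rintro ⟨c, h1, h2, h3⟩
    refine ⟨⟨c, h2⟩, h1, ?_⟩
    rwa [Fin.lt_def, ← entry_mk π ⟨c, _⟩, ← entry_mk π b]
  · rintro ⟨c, h1, h2⟩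
    exact ⟨c, h1, c.2, by rwa [entry_mk, entry_mk]⟩

theorem ne_iff : NE ⟨n, π⟩ b ↔ ∃ c > b, π b < π c := by
  constructor
  · rintro ⟨c, h1, h2, h3⟩
    refine ⟨⟨c, h2⟩, h1, ?_⟩
    rwa [Fin.lt_def, ← entry_mk π ⟨c, _⟩, ← entry_mk π b]
  · rintro ⟨c, h1, h2⟩
    exact ⟨c, h1, c.2, by rwa [entry_mk, entry_mk]⟩

theorem not_isLRMin_iff : ¬ IsLRMin π b ↔ SW ⟨n, π⟩ b := by
  rw [sw_iff, IsLRMin]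
  push Not
  exact exists_congr fun a => and_congr_right fun h =>
    ⟨fun h' => lt_of_le_of_ne h' fun e => h.ne (π.injective e), le_of_lt⟩

theorem not_isRLMin_iff : ¬ IsRLMin π b ↔ SE ⟨n, π⟩ b := by
  rw [se_iff, IsRLMin]
  push Not
  exact exists_congr fun a => and_congr_right fun h =>
    ⟨fun h' => lt_of_le_of_ne h' fun e => h.ne' (π.injective e), le_of_lt⟩

theorem forall_fin_iff {p : ℕ → Prop} :
    (∀ b < (⟨n, π⟩ : SizedPerm).1, p b) ↔ ∀ b : Fin n, p b :=
  ⟨fun h b => h b b.2, fun h b hb => h ⟨b, hb⟩⟩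

/-- The entry at `a` is not a right-left minimum. If it is not a source already, it is a left-right
minimum, and the first entry is even larger. -/
theorem exists_source_left {a : Fin n} (hab : a < b) (h : π b < π a) :
    ∃ a' < b, IsSource π a' ∧ π b < π a' := by
  by_cases ha : IsLRMin π a
  · let z : Fin n := ⟨0, by omega⟩
    refine ⟨z, lt_of_le_of_lt (Nat.zero_le _) hab, .inl rfl, ?_⟩
    rcases eq_or_ne z a with e | e
    · rwa [e]
    · exact h.trans (ha z (lt_of_le_of_ne (Nat.zero_le _) e))
  · exact ⟨a, hab, .inr (.inr ⟨ha, fun hr => h.not_gt (hr b hab)⟩), h⟩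

theorem exists_source_right {c : Fin n} (hbc : b < c) (h : π b < π c) :
    ∃ c' > b, IsSource π c' ∧ π b < π c' := by
  by_cases hc : IsRLMin π c
  · let z : Fin n := ⟨n - 1, by omega⟩
    have hcz : c ≤ z := Nat.le_sub_one_of_lt c.2
    refine ⟨z, lt_of_lt_of_le hbc hcz, .inr (.inl (by dsimp only [z]; omega)), ?_⟩
    rcases eq_or_ne c z with e | e
    · rwa [← e]
    · exact h.trans (hc z (lt_of_le_of_ne hcz e))
  · exact ⟨c, hbc, .inr (.inr ⟨fun hl => h.not_gt (hl b hbc), hc⟩), h⟩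

/-- An entry with four occupied quadrants is a source with larger sources on both sides, so the
sources have a valley there. -/
theorem fourFaces_of_isSquare (h : IsSquare π) : FourFaces ⟨n, π⟩ := by
  obtain ⟨p, hmono, hanti⟩ := h
  refine forall_fin_iff.2 fun b hSW hSE hNW hNE => ?_
  have hb : IsSource π b := .inr (.inr ⟨not_isLRMin_iff.2 hSW, not_isRLMin_iff.2 hSE⟩)
  obtain ⟨a, hab, ha⟩ := nw_iff.1 hNW
  obtain ⟨c, hbc, hc⟩ := ne_iff.1 hNE
  obtain ⟨a, hab, has, ha⟩ := exists_source_left hab ha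
  obtain ⟨c, hbc, hcs, hc⟩ := exists_source_right hbc hc
  by_cases hbp : (b : ℕ) ≤ p
  · exact ha.not_gt (hmono ⟨has, (Fin.lt_def.1 hab).le.trans hbp⟩ ⟨hb, hbp⟩ hab)
  · exact hc.not_gt (hanti ⟨hb, (not_le.1 hbp).le⟩
      ⟨hcs, (not_le.1 hbp).le.trans (Fin.lt_def.1 hbc).le⟩ hbc)

theorem isSquare_of_fourFaces (h : FourFaces ⟨n, π⟩) : IsSquare π := by
  have h := forall_fin_iff.1 h
  rcases Nat.eq_zero_or_pos n with rfl | hn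
  · exact ⟨0, fun i => i.elim0, fun i => i.elim0⟩
  have inner : ∀ b : Fin n, IsSource π b → (∃ a < b, π b < π a) → (∃ c > b, π b < π c) → False := by
    rintro b hb hNW hNE
    obtain ⟨a, hab, -⟩ := id hNW
    obtain ⟨c, hbc, -⟩ := id hNE
    rcases hb with hb | hb | ⟨h1, h2⟩
    · rw [Fin.lt_def] at hab
      omega
    · rw [gt_iff_lt, Fin.lt_def] at hbc
      omega
    · exact h b (not_isLRMin_iff.1 h1) (not_isRLMin_iff.1 h2) (nw_iff.2 hNW) (ne_iff.2 hNE)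
  let z : Fin n := ⟨n - 1, by omega⟩
  have hmax : ∀ i, i ≠ π.symm z → π i < π (π.symm z) := fun i hi => by
    rw [Equiv.apply_symm_apply]
    exact lt_of_le_of_ne (Nat.le_sub_one_of_lt (π i).2) fun e => hi (by rw [← e, π.symm_apply_apply])
  -- The faces change at the largest entry. A source breaking monotonicity on either side of it has
  -- larger entries both to its left and to its right.
  refine ⟨π.symm z, ?_, ?_⟩
  · rintro a ⟨-, -⟩ b ⟨hb, hbp⟩ hab
    by_contra! hle
    have hlt : π b < π a := lt_of_le_of_ne hle fun e => hab.ne' (π.injective e)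
    have hne : b ≠ π.symm z := fun e => by
      subst e
      exact hlt.not_gt (hmax a hab.ne)
    exact inner b hb ⟨a, hab, hlt⟩ ⟨_, lt_of_le_of_ne hbp hne, hmax b hne⟩
  · rintro a ⟨ha, hap⟩ b ⟨-, -⟩ hab
    by_contra! hle
    have hlt : π a < π b := lt_of_le_of_ne hle fun e => hab.ne (π.injective e)
    have hne : a ≠ π.symm z := fun e => by
      subst e
      exact hlt.not_gt (hmax b hab.ne')
    exact inner a ha ⟨_, lt_of_le_of_ne hap hne.symm, hmax a hne⟩ ⟨b, hab, hlt⟩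

end Fin

theorem isSquare_iff (s : SizedPerm) : IsSquare s.2 ↔ s.FourFaces :=
  ⟨fourFaces_of_isSquare, isSquare_of_fourFaces⟩

/-! ### The graph of the complement of a permutation -/

/-- The graph of the complement of a permutation. -/
def graph (s : SizedPerm) : Set (ℤ × ℤ) :=
  Set.range fun i : Fin s.1 => (((i : ℕ) : ℤ) + 1, (((s.2.trans Fin.revPerm) i : ℕ) : ℤ) + 1)

theorem mem_graph {s : SizedPerm} {p : ℤ × ℤ} :
    p ∈ graph s ↔ ∃ i < s.1, p = ((i : ℤ) + 1, (s.1 : ℤ) - s.entry i) := by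
  have h : ∀ i : Fin s.1, (((i : ℕ) : ℤ) + 1, (((s.2.trans Fin.revPerm) i : ℕ) : ℤ) + 1) =
      (((i : ℕ) : ℤ) + 1, (s.1 : ℤ) - s.entry i) := fun i => by
    refine Prod.ext rfl ?_
    have := (s.2 i).2
    simp only [Equiv.trans_apply, Fin.revPerm_apply, Fin.val_rev, entry_coe]
    omega
  constructor
  · rintro ⟨i, rfl⟩
    exact ⟨i, i.2, h i⟩
  · rintro ⟨i, hi, rfl⟩
    exact ⟨⟨i, hi⟩, h ⟨i, hi⟩⟩

theorem isPermSet_graph (s : SizedPerm) : IsPermSet s.1 (graph s) := isPermSet_range _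

theorem graph_injective {s t : SizedPerm} (h₁ : s.1 = t.1) (h : graph s = graph t) : s = t := by
  refine ext_entry h₁ fun i hi => ?_
  obtain ⟨j, hj, e⟩ := mem_graph.1 (h ▸ mem_graph.2 ⟨i, hi, rfl⟩)
  obtain ⟨e1, e2⟩ := Prod.mk.inj e
  obtain rfl : i = j := by omega
  omega

theorem occNW_graph {s : SizedPerm} {i : ℕ} :
    OccNW (graph s) ((i : ℤ) + 1, (s.1 : ℤ) - s.entry i) ↔ ∃ j < s.1, j < i ∧
      s.entry j < s.entry i := by
  constructor
  · rintro ⟨q, hq, h1, h2⟩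
    obtain ⟨j, hj, rfl⟩ := mem_graph.1 hq
    dsimp only at h1 h2
    exact ⟨j, hj, by omega, by omega⟩
  · rintro ⟨j, hj, h1, h2⟩
    exact ⟨_, mem_graph.2 ⟨j, hj, rfl⟩, by dsimp only; omega, by dsimp only; omega⟩

theorem occSE_graph {s : SizedPerm} {i : ℕ} :
    OccSE (graph s) ((i : ℤ) + 1, (s.1 : ℤ) - s.entry i) ↔ s.NE i := by
  constructor
  · rintro ⟨q, hq, h1, h2⟩
    obtain ⟨j, hj, rfl⟩ := mem_graph.1 hq
    dsimp only at h1 h2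
    exact ⟨j, by omega, hj, by omega⟩
  · rintro ⟨j, h1, hj, h2⟩
    exact ⟨_, mem_graph.2 ⟨j, hj, rfl⟩, by dsimp only; omega, by dsimp only; omega⟩

theorem occNE_graph {s : SizedPerm} {i : ℕ} :
    OccNE (graph s) ((i : ℤ) + 1, (s.1 : ℤ) - s.entry i) ↔ s.SE i := by
  constructor
  · rintro ⟨q, hq, h1, h2⟩
    obtain ⟨j, hj, rfl⟩ := mem_graph.1 hq
    dsimp only at h1 h2
    exact ⟨j, by omega, hj, by omega⟩
  · rintro ⟨j, h1, hj, h2⟩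
    exact ⟨_, mem_graph.2 ⟨j, hj, rfl⟩, by dsimp only; omega, by dsimp only; omega⟩

theorem sw_iff_of_lt {s : SizedPerm} {i : ℕ} (hi : i < s.1) :
    (∃ j < s.1, j < i ∧ s.entry j < s.entry i) ↔ s.SW i :=
  ⟨fun ⟨j, _, h⟩ => ⟨j, h⟩, fun ⟨j, h⟩ => ⟨j, h.1.trans hi, h⟩⟩

theorem forall_mem_graph {s : SizedPerm} {p : ℤ × ℤ → Prop} :
    (∀ q ∈ graph s, p q) ↔ ∀ i < s.1, p ((i : ℤ) + 1, (s.1 : ℤ) - s.entry i) := by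
  constructor
  · exact fun h i hi => h _ (mem_graph.2 ⟨i, hi, rfl⟩)
  · intro h q hq
    obtain ⟨i, hi, rfl⟩ := mem_graph.1 hq
    exact h i hi

theorem threeFaced_graph {s : SizedPerm} : ThreeFaced (graph s) ↔ s.LastFaces := by
  rw [ThreeFaced, forall_mem_graph]
  refine forall₂_congr fun i hi => ?_
  rw [occNW_graph, occSE_graph, occNE_graph, sw_iff_of_lt hi]
  tauto

theorem twoFaced_graph {s : SizedPerm} : TwoFaced (graph s) ↔ s.MidFaces := by
  rw [TwoFaced, forall_mem_graph]
  refine forall₂_congr fun i hi => ?_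
  rw [occNW_graph, occSE_graph, sw_iff_of_lt hi]

theorem Indec.graph {s : SizedPerm} (h : s.Indec) : IsIndec s.1 (graph s) := by
  refine (isPermSet_graph s).isIndec fun x h1 h2 => .inl ?_
  obtain ⟨m, rfl⟩ := Int.eq_ofNat_of_zero_le (show 0 ≤ x by omega)
  obtain ⟨i, hi, h3⟩ := (indec_iff.1 h).2 m (by omega) (by omega)
  exact ⟨_, mem_graph.2 ⟨i, by omega, rfl⟩, by dsimp only; omega, by dsimp only; omega⟩

theorem indec_of_graph {s : SizedPerm} (hs : 0 < s.1) (h : IsIndec s.1 (SizedPerm.graph s)) :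
    s.Indec := by
  refine indec_iff.2 ⟨hs, fun m h1 h2 => ?_⟩
  obtain ⟨p, hp, h3, h4⟩ := h.above m (by omega) (by omega)
  obtain ⟨i, hi, rfl⟩ := mem_graph.1 hp
  dsimp only at h3 h4
  exact ⟨i, by omega, by omega⟩

/-! ### The permutomino of a permutation -/

open Classical in
/-- The cells of the permutomino of a permutation. -/
noncomputable def cells (s : SizedPerm) : Finset (ℤ × ℤ) :=
  (Finset.Icc (1 : ℤ) s.1 ×ˢ Finset.Icc (1 : ℤ) s.1).filter (Region (graph s))

theorem mem_cells (s : SizedPerm) (c : ℤ × ℤ) : c ∈ cells s ↔ Region (graph s) c := by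
  classical
  rw [cells, Finset.mem_filter, and_iff_right_iff_imp]
  intro h
  have := h.bound (isPermSet_graph s)
  rw [Finset.mem_product, Finset.mem_Icc, Finset.mem_Icc]
  omega

theorem cells_eq_empty {s : SizedPerm} (h : s.1 = 1) : cells s = ∅ := by
  refine Finset.eq_empty_of_forall_notMem fun c hc => ?_
  have := ((mem_cells s c).1 hc).bound (isPermSet_graph s)
  omega

theorem cells_spec {s : SizedPerm} (h : s.Indec) (hf : s.LastFaces) (hs : s.1 ≠ 1) :
    IsPermutomino (cells s) ∧ IsConvex (cells s) ∧ IsDirected (cells s) ∧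
      size (cells s) = s.1 := by
  have hpos := h.pos
  have hS := isPermSet_graph s
  have hI := h.graph
  obtain ⟨n, hn⟩ := Nat.exists_eq_add_of_le' h.pos
  rw [hn] at hS hI ⊢
  exact isPermutomino_of_region hS hI (threeFaced_graph.2 hf) (by omega) (mem_cells s)

theorem size_cells {s : SizedPerm} (h : s.Indec) (hf : s.LastFaces) : size (cells s) = s.1 := by
  by_cases hs : s.1 = 1
  · rw [cells_eq_empty hs, hs]
    rfl
  · exact (cells_spec h hf hs).2.2.2

theorem evenVertices_cells {s : SizedPerm} (h : s.Indec) (hf : s.LastFaces) (hs : s.1 ≠ 1) :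
    evenVertices (cells s) = graph s :=
  evenVertices_of_region (isPermSet_graph s) h.graph (threeFaced_graph.2 hf)
    (by have := h.pos; omega) (mem_cells s)

/-! ### Classes of components and their bijections with permutominoes. -/

/-- The permutations of the last component of a square permutation. -/
def lastClass : Set SizedPerm := {s | s.Indec ∧ s.LastFaces}

/-- The permutations of the first component of a square permutation. -/
def firstClass : Set SizedPerm := {s | s.Indec ∧ s.FirstFaces}

/-- The permutations of the inner components of a square permutation. -/
def midClass : Set SizedPerm := {s | s.Indec ∧ s.MidFaces}

/-- The inverse map takes the complement of the permutation of even vertices. Size 1 is treated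
apart, as the empty permutomino has no vertices. -/
theorem bijOn_cells : Set.BijOn cells lastClass directedConvex := by
  refine ⟨?_, ?_, ?_⟩
  · rintro s ⟨h, hf⟩
    by_cases hs : s.1 = 1
    · exact .inl (cells_eq_empty hs)
    · obtain ⟨h1, h2, h3, -⟩ := cells_spec h hf hs
      exact .inr ⟨h1, h2, h3⟩
  · rintro s ⟨h, hf⟩ t ⟨h', hf'⟩ e
    have h1 : s.1 = t.1 := by rw [← size_cells h hf, e, size_cells h' hf']
    by_cases hs : s.1 = 1
    · refine ext_entry h1 fun i hi => ?_
      have h2 := s.entry_lt hi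
      have h3 := t.entry_lt (h1 ▸ hi)
      omega
    · refine graph_injective h1 ?_
      rw [← evenVertices_cells h hf hs, e, evenVertices_cells h' hf' (h1 ▸ hs)]
  · rintro P (rfl | ⟨⟨-, -, n, hn, hfst, -, -, π, hπ⟩, hc, hd⟩)
    · refine ⟨⟨1, 1⟩, ⟨indec_iff.2 ⟨one_pos, fun m hm hm' => ?_⟩, ?_⟩, cells_eq_empty rfl⟩
      · dsimp only at hm'
        omega
      · rintro b hb ⟨a, ha, -⟩
        dsimp only at hb
        omega
    -- Complementing twice is the identity, so the graph of `s` is the set of even vertices.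
    · let s : SizedPerm := ⟨n + 1, π.trans Fin.revPerm⟩
      have hg : evenVertices P = graph s := by
        rw [hπ]
        simp [graph, s]
      have hI : IsIndec s.1 (graph s) := by
        rw [← hg]
        refine isIndec_evenVertices (hg ▸ isPermSet_graph s) fun x h1 h2 => ?_
        have hx : x ∈ P.image Prod.fst := by
          rw [hfst, Finset.mem_Icc]
          dsimp only [s] at h2
          omega
        obtain ⟨c, hc, rfl⟩ := Finset.mem_image.1 hx
        exact ⟨c.2, hc⟩
      refine ⟨s, ⟨indec_of_graph (Nat.succ_pos n) hI, threeFaced_graph.1 ?_⟩, ?_⟩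
      · rw [← hg]
        exact threeFaced_evenVertices hc hd
      · ext c
        rw [mem_cells, ← hg, mem_iff_region hc hd]

theorem parallelogram_subset : parallelogram ⊆ directedConvex := by
  rintro P (rfl | ⟨h, hp⟩)
  · exact .inl rfl
  · refine .inr ⟨h, hp.isConvex, ?_⟩
    obtain ⟨⟨hne, -⟩, -, n, -, hfst, hsnd, -, -⟩ := h
    refine hp.isDirected hne fun c hc => ⟨?_, ?_⟩
    · have := Finset.mem_image_of_mem Prod.fst hc
      rw [hfst, Finset.mem_Icc] at this
      exact this.1
    · have := Finset.mem_image_of_mem Prod.snd hc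
      rw [hsnd, Finset.mem_Icc] at this
      exact this.1

theorem midClass_subset : midClass ⊆ lastClass := fun _ h => ⟨h.1, h.2.lastFaces⟩

theorem bijOn_cells_mid : Set.BijOn cells midClass parallelogram := by
  refine ⟨?_, bijOn_cells.injOn.mono midClass_subset, ?_⟩
  · rintro s ⟨h, hf⟩
    by_cases hs : s.1 = 1
    · exact .inl (cells_eq_empty hs)
    · exact .inr ⟨(cells_spec h hf.lastFaces hs).1, isParallelogram_of_region (isPermSet_graph s)
        h.graph (twoFaced_graph.2 hf) h.pos (mem_cells s)⟩
  · intro P hP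
    obtain ⟨s, ⟨h, hf⟩, rfl⟩ := bijOn_cells.surjOn (parallelogram_subset hP)
    refine ⟨s, ⟨h, ?_⟩, rfl⟩
    rcases hP with hP | ⟨-, hP⟩
    · have h1 := size_cells h hf
      rw [hP] at h1
      have hs : s.1 = 1 := h1.symm
      rintro b hb ⟨a, ha, -⟩
      omega
    · exact twoFaced_graph.1 (twoFaced_of_isParallelogram (isPermSet_graph s)
        (threeFaced_graph.2 hf) (mem_cells s) hP)

theorem bijOn_inv : Set.BijOn inv firstClass lastClass := by
  refine ⟨fun s h => ⟨h.1.inv, h.2.inv⟩, fun s _ t _ h => ?_, fun s h => ?_⟩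
  · rw [← s.inv_inv, h, t.inv_inv]
  · exact ⟨s.inv, ⟨h.1.inv, h.2.inv⟩, s.inv_inv⟩

end SizedPerm
/-! ### Generating functions of weighted classes -/

/-- The generating function of the set `A` with respect to the weight `w`. -/
noncomputable def genOf {α : Type*} (w : α → ℕ) (A : Set α) : PowerSeries ℚ :=
  PowerSeries.mk fun n => ({a | a ∈ A ∧ w a = n}.ncard : ℚ)

/-- There are finitely many elements of `A` of each weight. -/
def FinFib {α : Type*} (w : α → ℕ) (A : Set α) : Prop := ∀ n, {a | a ∈ A ∧ w a = n}.Finite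

section GenOf

variable {α β γ : Type*} {u : α → ℕ} {v : β → ℕ} {w : γ → ℕ}

theorem genOf_bijOn {A : Set α} {B : Set β} {f : α → β} (h : Set.BijOn f A B)
    (hw : ∀ a ∈ A, v (f a) = u a) : genOf u A = genOf v B := by
  ext n
  rw [genOf, genOf, PowerSeries.coeff_mk, PowerSeries.coeff_mk]
  have : {b | b ∈ B ∧ v b = n} = f '' {a | a ∈ A ∧ u a = n} := by
    ext b
    constructor
    · rintro ⟨hb, hn⟩
      obtain ⟨a, ha, rfl⟩ := h.surjOn hb
      exact ⟨a, ⟨ha, (hw a ha).symm.trans hn⟩, rfl⟩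
    · rintro ⟨a, ⟨ha, hn⟩, rfl⟩
      exact ⟨h.mapsTo ha, (hw a ha).trans hn⟩
  rw [this, (h.injOn.mono fun a ha => ha.1).ncard_image]

theorem genOf_union {A B : Set α} (hA : FinFib u A) (hB : FinFib u B) (hd : Disjoint A B) :
    genOf u (A ∪ B) = genOf u A + genOf u B := by
  ext n
  rw [map_add, genOf, genOf, genOf, PowerSeries.coeff_mk, PowerSeries.coeff_mk,
    PowerSeries.coeff_mk, ← Nat.cast_add, ← Set.ncard_union_eq (hd.mono (fun a h => h.1)
      fun a h => h.1) (hA n) (hB n)]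
  congr 2
  ext a
  simp only [Set.mem_union, Set.mem_ofPred_eq]
  tauto

theorem image2_fiber {A : Set α} {B : Set β} {f : α → β → γ} (hA : FinFib u A) (hB : FinFib v B)
    (hw : ∀ a ∈ A, ∀ b ∈ B, w (f a b) = u a + v b) (n : ℕ) [DecidableEq γ] :
    {c | c ∈ Set.image2 f A B ∧ w c = n} =
      (((Finset.HasAntidiagonal.antidiagonal n).sigma fun p => (hA p.1).toFinset ×ˢ (hB p.2).toFinset).image
        fun x => f x.2.1 x.2.2 : Finset γ) := by
  ext c
  simp only [Set.mem_ofPred_eq, Finset.coe_image, Set.mem_image, Finset.mem_coe, Finset.mem_sigma,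
    Finset.mem_product, Set.Finite.mem_toFinset, Finset.HasAntidiagonal.mem_antidiagonal]
  constructor
  · rintro ⟨⟨a, ha, b, hb, rfl⟩, hn⟩
    exact ⟨⟨(u a, v b), (a, b)⟩, ⟨(hw a ha b hb).symm.trans hn, ⟨ha, rfl⟩, ⟨hb, rfl⟩⟩, rfl⟩
  · rintro ⟨⟨p, a, b⟩, ⟨hp, ⟨ha, hu⟩, ⟨hb, hv⟩⟩, rfl⟩
    dsimp only at *
    exact ⟨⟨a, ha, b, hb, rfl⟩, by rw [hw a ha b hb, hu, hv, hp]⟩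

theorem FinFib.image2 {A : Set α} {B : Set β} {f : α → β → γ} (hA : FinFib u A) (hB : FinFib v B)
    (hw : ∀ a ∈ A, ∀ b ∈ B, w (f a b) = u a + v b) : FinFib w (Set.image2 f A B) := fun n => by
  classical
  rw [image2_fiber hA hB hw]
  exact Finset.finite_toSet _

theorem genOf_image2 {A : Set α} {B : Set β} {f : α → β → γ} (hA : FinFib u A) (hB : FinFib v B)
    (hw : ∀ a ∈ A, ∀ b ∈ B, w (f a b) = u a + v b)
    (hf : ∀ a ∈ A, ∀ b ∈ B, ∀ a' ∈ A, ∀ b' ∈ B, f a b = f a' b' → a = a' ∧ b = b') :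
    genOf w (Set.image2 f A B) = genOf u A * genOf v B := by
  classical
  ext n
  rw [PowerSeries.coeff_mul, genOf, PowerSeries.coeff_mk, image2_fiber hA hB hw,
    Set.ncard_coe_finset, Finset.card_image_of_injOn, Finset.card_sigma, Nat.cast_sum]
  · refine Finset.sum_congr rfl fun p _ => ?_
    rw [Finset.card_product, Nat.cast_mul, genOf, genOf, PowerSeries.coeff_mk,
      PowerSeries.coeff_mk, Set.ncard_eq_toFinset_card _ (hA _),
      Set.ncard_eq_toFinset_card _ (hB _)]
  · rintro ⟨p, a, b⟩ hx ⟨p', a', b'⟩ hx' h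
    simp only [Finset.mem_coe, Finset.mem_sigma, Finset.mem_product, Set.Finite.mem_toFinset,
      Finset.HasAntidiagonal.mem_antidiagonal, Set.mem_ofPred_eq] at hx hx'
    obtain ⟨-, ⟨ha, hu⟩, ⟨hb, hv⟩⟩ := hx
    obtain ⟨-, ⟨ha', hu'⟩, ⟨hb', hv'⟩⟩ := hx'
    obtain ⟨rfl, rfl⟩ := hf a ha b hb a' ha' b' hb' h
    obtain rfl : p = p' := Prod.ext (hu.symm.trans hu') (hv.symm.trans hv')
    rfl

theorem seq_succ_eq_image2 {k : ℕ} (S : Fin (k + 1) → Set α) :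
    {s : Fin (k + 1) → α | ∀ i, s i ∈ S i} =
      Set.image2 (fun a (t : Fin k → α) => (Fin.cons a t : Fin (k + 1) → α)) (S 0)
        {t | ∀ i, t i ∈ S i.succ} := by
  ext s
  constructor
  · exact fun h => ⟨s 0, h 0, fun i => s i.succ, fun i => h i.succ, Fin.cons_self_tail s⟩
  · rintro ⟨a, ha, t, ht, rfl⟩ i
    exact Fin.cases ha ht i

theorem finFib_seq {k : ℕ} (S : Fin k → Set α) (hS : ∀ i, FinFib u (S i)) :
    FinFib (fun s : Fin k → α => ∑ i, u (s i)) {s | ∀ i, s i ∈ S i} := by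
  induction k with
  | zero => exact fun n => Set.toFinite _
  | succ k ih =>
    rw [seq_succ_eq_image2]
    exact FinFib.image2 (hS 0) (ih (fun i => S i.succ) fun i => hS i.succ)
      fun a _ t _ => by simp [Fin.sum_univ_succ]

theorem genOf_seq {k : ℕ} (S : Fin k → Set α) (hS : ∀ i, FinFib u (S i)) :
    genOf (fun s : Fin k → α => ∑ i, u (s i)) {s | ∀ i, s i ∈ S i} = ∏ i, genOf u (S i) := by
  induction k with
  | zero =>
    ext n
    rw [Fin.prod_univ_zero, PowerSeries.coeff_one, genOf, PowerSeries.coeff_mk]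
    rcases eq_or_ne n 0 with rfl | hn
    · simp
    · simp [hn, hn.symm]
  | succ k ih =>
    rw [seq_succ_eq_image2, Fin.prod_univ_succ, ← ih _ fun i => hS i.succ]
    refine genOf_image2 (hS 0) (finFib_seq _ fun i => hS i.succ)
      (fun a _ t _ => by simp [Fin.sum_univ_succ]) ?_
    intro a _ t _ a' _ t' _ h
    exact Fin.cons_inj.1 h

end GenOf

/-! ### Components of square permutations -/

namespace SizedPerm

theorem finFib_fst (A : Set SizedPerm) : FinFib Sigma.fst A := fun n =>
  (Set.finite_range (fun π : Equiv.Perm (Fin n) => (⟨n, π⟩ : SizedPerm))).subset (by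
    rintro ⟨m, π⟩ ⟨-, rfl⟩
    exact ⟨π, rfl⟩)

theorem genOf_fst (A : Set SizedPerm) :
    genOf Sigma.fst A = PowerSeries.mk fun n =>
      ({π : Equiv.Perm (Fin n) | (⟨n, π⟩ : SizedPerm) ∈ A}.ncard : ℚ) := by
  ext n
  rw [genOf, PowerSeries.coeff_mk, PowerSeries.coeff_mk,
    ← Set.ncard_image_of_injective _
      (fun _ _ h => eq_of_heq (Sigma.mk.inj h).2 : Function.Injective
        fun π : Equiv.Perm (Fin n) => (⟨n, π⟩ : SizedPerm))]
  congr 2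
  ext ⟨m, π⟩
  constructor
  · rintro ⟨h, rfl⟩
    exact ⟨π, h, rfl⟩
  · rintro ⟨σ, h, e⟩
    cases e
    exact ⟨h, rfl⟩

theorem isDiffOf_succ {k : ℕ} {s : SizedPerm} : IsDiffOf (k + 1) s.2 ↔
    (k = 0 ∧ s.Indec) ∨ ∃ a b : SizedPerm, a.Indec ∧ IsDiffOf k b.2 ∧ diff a b = s := by
  constructor
  · obtain ⟨n, π⟩ := s
    intro h
    cases h with
    | one _ h => exact .inl ⟨rfl, h⟩
    | cons θ σ h h' => exact .inr ⟨⟨_, θ⟩, ⟨_, σ⟩, h, h', rfl⟩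
  · rintro (⟨rfl, h⟩ | ⟨a, b, ha, hb, rfl⟩)
    · exact .one _ h
    · exact .cons _ _ ha hb

theorem not_isDiffOf_zero {s : SizedPerm} : ¬ IsDiffOf 0 s.2 := by
  obtain ⟨n, π⟩ := s
  intro h
  cases h

theorem pos_of_isDiffOf {k : ℕ} {s : SizedPerm} (h : IsDiffOf k s.2) : 0 < s.1 := by
  rcases k with - | k
  · exact absurd h not_isDiffOf_zero
  · rcases isDiffOf_succ.1 h with ⟨-, h⟩ | ⟨a, b, ha, -, rfl⟩
    · exact h.pos
    · have := ha.pos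
      rw [diff_fst]
      omega

/-! ### Recursive structure and enumeration of square permutations. -/

/-- Direct differences of `k` indecomposable permutations which can end a square permutation. -/
def tailClass (k : ℕ) : Set SizedPerm := {s | IsDiffOf k s.2 ∧ s.LastFaces}

/-- Permutations which can end a square permutation. -/
def tailClassUnion : Set SizedPerm := {s | (∃ k, IsDiffOf k s.2) ∧ s.LastFaces}

theorem tailClass_one : tailClass 1 = lastClass := by
  ext s
  refine and_congr_left fun _ => ?_
  rw [isDiffOf_succ]
  refine ⟨?_, fun h => .inl ⟨rfl, h⟩⟩
  rintro (⟨-, h⟩ | ⟨a, b, -, h, -⟩)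
  · exact h
  · exact absurd h not_isDiffOf_zero

theorem tailClass_succ (k : ℕ) :
    tailClass (k + 2) = Set.image2 diff midClass (tailClass (k + 1)) := by
  ext s
  constructor
  · rintro ⟨h, hf⟩
    rcases isDiffOf_succ.1 h with ⟨h, -⟩ | ⟨a, b, ha, hb, rfl⟩
    · omega
    · obtain ⟨h1, h2⟩ := (lastFaces_diff (pos_of_isDiffOf hb)).1 hf
      exact ⟨a, ⟨ha, h1⟩, b, ⟨hb, h2⟩, rfl⟩
  · rintro ⟨a, ⟨ha, h1⟩, b, ⟨hb, h2⟩, rfl⟩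
    exact ⟨isDiffOf_succ.2 (.inr ⟨a, b, ha, hb, rfl⟩),
      (lastFaces_diff (pos_of_isDiffOf hb)).2 ⟨h1, h2⟩⟩

/-- Splitting off the first component gives the series identity `T = D + P T`, which replaces the
summation over `k`. -/
theorem tailClassUnion_eq :
    tailClassUnion = lastClass ∪ Set.image2 diff midClass tailClassUnion := by
  ext s
  constructor
  · rintro ⟨⟨k, h⟩, hf⟩
    rcases k with - | k
    · exact absurd h not_isDiffOf_zero
    · rcases isDiffOf_succ.1 h with ⟨-, h⟩ | ⟨a, b, ha, hb, rfl⟩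
      · exact .inl ⟨h, hf⟩
      · obtain ⟨h1, h2⟩ := (lastFaces_diff (pos_of_isDiffOf hb)).1 hf
        exact .inr ⟨a, ⟨ha, h1⟩, b, ⟨⟨k, hb⟩, h2⟩, rfl⟩
  · rintro (⟨h, hf⟩ | ⟨a, ⟨ha, h1⟩, b, ⟨⟨k, hb⟩, h2⟩, rfl⟩)
    · exact ⟨⟨1, isDiffOf_succ.2 (.inl ⟨rfl, h⟩)⟩, hf⟩
    · exact ⟨⟨k + 1, isDiffOf_succ.2 (.inr ⟨a, b, ha, hb, rfl⟩)⟩,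
        (lastFaces_diff (pos_of_isDiffOf hb)).2 ⟨h1, h2⟩⟩

theorem genOf_diff {A B : Set SizedPerm} (hA : ∀ s ∈ A, s.Indec) :
    genOf Sigma.fst (Set.image2 diff A B) = genOf Sigma.fst A * genOf Sigma.fst B :=
  genOf_image2 (finFib_fst A) (finFib_fst B) (fun _ _ _ _ => rfl)
    fun a ha _ _ a' ha' _ _ h => diff_injective (hA a ha) (hA a' ha') h

theorem genOf_lastClass : genOf Sigma.fst lastClass = genD :=
  genOf_bijOn bijOn_cells fun _ h => size_cells h.1 h.2

theorem genOf_midClass : genOf Sigma.fst midClass = genP :=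
  genOf_bijOn bijOn_cells_mid fun _ h => size_cells h.1 h.2.lastFaces

theorem genOf_firstClass : genOf Sigma.fst firstClass = genD :=
  (genOf_bijOn bijOn_inv fun _ _ => rfl).trans genOf_lastClass

theorem genOf_tailClass (k : ℕ) : genOf Sigma.fst (tailClass (k + 1)) = genP ^ k * genD := by
  induction k with
  | zero => rw [tailClass_one, genOf_lastClass, pow_zero, one_mul]
  | succ k ih =>
    rw [tailClass_succ, genOf_diff fun s h => h.1, ih, genOf_midClass, pow_succ']
    ring

theorem genOf_tailClassUnion : genOf Sigma.fst tailClassUnion * (1 - genP) = genD := by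
  have hd : Disjoint lastClass (Set.image2 diff midClass tailClassUnion) := by
    rw [Set.disjoint_left]
    rintro _ ⟨h, -⟩ ⟨a, ⟨ha, -⟩, b, ⟨⟨k, hb⟩, -⟩, rfl⟩
    exact not_indec_diff ha.pos (pos_of_isDiffOf hb) h
  have h := genOf_union (finFib_fst _) (finFib_fst _) hd
  rw [← tailClassUnion_eq, genOf_lastClass, genOf_diff fun s h => h.1, genOf_midClass] at h
  linear_combination h

theorem mem_permClass_iff {k : ℕ} {s : SizedPerm} : s.2 ∈ permClass s.1 (k + 2) ↔
    s ∈ Set.image2 diff firstClass (tailClass (k + 1)) := by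
  constructor
  · rintro ⟨hs, h⟩
    rcases isDiffOf_succ.1 h with ⟨h, -⟩ | ⟨a, b, ha, hb, rfl⟩
    · omega
    · obtain ⟨h1, h2⟩ := (fourFaces_diff ha.pos (pos_of_isDiffOf hb)).1 ((isSquare_iff _).1 hs)
      exact ⟨a, ⟨ha, h1⟩, b, ⟨hb, h2⟩, rfl⟩
  · rintro ⟨a, ⟨ha, h1⟩, b, ⟨hb, h2⟩, rfl⟩
    exact ⟨(isSquare_iff _).2 ((fourFaces_diff ha.pos (pos_of_isDiffOf hb)).2 ⟨h1, h2⟩),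
      isDiffOf_succ.2 (.inr ⟨a, b, ha, hb, rfl⟩)⟩

theorem mem_permClassUnion_iff {s : SizedPerm} : s.2 ∈ permClassUnion s.1 ↔
    s ∈ Set.image2 diff firstClass tailClassUnion := by
  constructor
  · rintro ⟨k, hk, h⟩
    obtain ⟨j, rfl⟩ := Nat.exists_eq_add_of_le' hk
    obtain ⟨a, ha, b, hb, rfl⟩ := mem_permClass_iff.1 h
    exact ⟨a, ha, b, ⟨⟨_, hb.1⟩, hb.2⟩, rfl⟩
  · rintro ⟨a, ha, b, ⟨⟨k, hb⟩, hf⟩, rfl⟩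
    rcases k with - | k
    · exact absurd hb not_isDiffOf_zero
    · exact ⟨k + 2, by omega, mem_permClass_iff.2 ⟨a, ha, b, ⟨hb, hf⟩, rfl⟩⟩

end SizedPerm

open SizedPerm

theorem genBk_eq (k : ℕ) : genBk (k + 2) = genD ^ 2 * genP ^ k := by
  have h : genBk (k + 2) = genOf Sigma.fst (Set.image2 diff firstClass (tailClass (k + 1))) := by
    rw [genOf_fst]
    simp only [← mem_permClass_iff]
    rfl
  rw [h, genOf_diff fun s h => h.1, genOf_firstClass, genOf_tailClass]
  ring

theorem genB_eq : genB = genD ^ 2 * (1 - genP)⁻¹ := by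
  have h : genB = genOf Sigma.fst (Set.image2 diff firstClass tailClassUnion) := by
    rw [genOf_fst]
    simp only [← mem_permClassUnion_iff]
    rfl
  rw [PowerSeries.eq_mul_inv_iff_mul_eq constantCoeff_one_sub_genP, h,
    genOf_diff fun s h => h.1, genOf_firstClass, mul_assoc, genOf_tailClassUnion, sq]

/-! ### Sequences of permutominoes -/

theorem finFib_directedConvex : FinFib size directedConvex := fun n =>
  (finite_of_size n).subset fun _ h => ⟨h.1.imp_right And.left, h.2⟩

/-- The class of the term with index `i` of the sequences of length `k`. -/
def termClass (k : ℕ) (i : Fin k) : Set (Finset (ℤ × ℤ)) :=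
  if (i : ℕ) = 0 ∨ (i : ℕ) + 1 = k then directedConvex else parallelogram

theorem finFib_termClass (k : ℕ) (i : Fin k) : FinFib size (termClass k i) := fun n =>
  (finFib_directedConvex n).subset fun P h => ⟨by
    have h1 := h.1
    unfold termClass at h1
    split_ifs at h1
    · exact h1
    · exact parallelogram_subset h1, h.2⟩

theorem seqClass_eq (n k : ℕ) :
    seqClass n k = {s | s ∈ {s | ∀ i, s i ∈ termClass k i} ∧ ∑ i, size (s i) = n} := by
  ext s
  rw [seqClass, Set.mem_ofPred_eq, Set.mem_ofPred_eq, ← and_assoc]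
  refine and_congr_left fun _ => ?_
  rw [← forall_and]
  refine forall_congr' fun i => ?_
  unfold termClass
  split_ifs with h
  · exact ⟨fun h' => h'.1 h, fun h' => ⟨fun _ => h', fun h1 h2 => (h.elim h1 h2).elim⟩⟩
  · rw [not_or] at h
    exact ⟨fun h' => h'.2 h.1 h.2, fun h' => ⟨fun h1 => (h1.elim h.1 h.2).elim, fun _ _ => h'⟩⟩

theorem ncard_seqClass (n k : ℕ) :
    ((seqClass n (k + 2)).ncard : ℚ) = PowerSeries.coeff n (genD ^ 2 * genP ^ k) := by
  have h := genOf_seq (termClass (k + 2)) (finFib_termClass (k + 2))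
  have hprod : ∏ i, genOf size (termClass (k + 2) i) = genD ^ 2 * genP ^ k := by
    rw [Fin.prod_univ_succ, Fin.prod_univ_castSucc]
    have h0 : termClass (k + 2) 0 = directedConvex := if_pos (.inl rfl)
    have h1 : termClass (k + 2) (Fin.last k).succ = directedConvex := if_pos (.inr (by simp))
    have h2 : ∀ i : Fin k, termClass (k + 2) i.castSucc.succ = parallelogram := fun i =>
      if_neg (by
        have := i.2
        simp only [Fin.val_succ, Fin.val_castSucc]
        omega)
    simp only [h0, h1, h2, Finset.prod_const, Finset.card_univ, Fintype.card_fin]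
    change genD * (genP ^ k * genD) = _
    ring
  rw [← hprod, ← h, genOf, PowerSeries.coeff_mk, seqClass_eq]

/-- Both numbers are the coefficient of `x^n` in `D² P^k`. -/
theorem ncard_permClass (n k : ℕ) :
    (permClass n (k + 2)).ncard = (seqClass n (k + 2)).ncard := by
  have h := congrArg (PowerSeries.coeff n) (genBk_eq k)
  rw [← ncard_seqClass, genBk, PowerSeries.coeff_mk] at h
  exact_mod_cast h

theorem finite_seqClass (n k : ℕ) : (seqClass n k).Finite := by
  rw [seqClass_eq]
  exact finFib_seq (termClass k) (finFib_termClass k) n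

end Permutomino

theorem mainTheorem4 :
    (∀ n k : ℕ, 2 ≤ k →
      Nonempty (Permutomino.permClass n k ≃ Permutomino.seqClass n k) ∧
      (Permutomino.permClass n k).ncard = (Permutomino.seqClass n k).ncard) ∧
    (∀ k : ℕ, 2 ≤ k →
      Permutomino.genBk k = Permutomino.genD ^ 2 * Permutomino.genP ^ (k - 2)) ∧
    Permutomino.genB = Permutomino.genD ^ 2 * (1 - Permutomino.genP)⁻¹ := by
  refine ⟨fun n k hk => ?_, fun k hk => ?_, Permutomino.genB_eq⟩
  · obtain ⟨j, rfl⟩ := Nat.exists_eq_add_of_le' hk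
    have h := Permutomino.ncard_permClass n j
    -- Finiteness is needed here: `ncard` is 0 on infinite sets, so equal values alone would not
    -- give a bijection.
    have := (Permutomino.finite_seqClass n (j + 2)).to_subtype
    exact ⟨Finite.card_eq.1 h, h⟩
  · obtain ⟨j, rfl⟩ := Nat.exists_eq_add_of_le' hk
    exact Permutomino.genBk_eq j
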